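/- **Setting.** Let $g,l,m>0$ and $\omega\in\mathbb R$. Let $p_+,p_-\in C^\infty(0,\infty)$ be nonnegative and strictly increasing with $1/p_\pm'\in L^\infty_{\rm loc}(0,\infty)$. Let $\rho_0$ be a function on $(-m,l)$ that is smooth on $(-m,0)$ and on $(0,l)$, bounded above and below there by positive constants, and such that $(p_-(\rho_0))'=-g\rho_0$ on $(-m,0)$ and $(p_+(\rho_0))'=-g\rho_0$ on $(0,l)$; the one-sided limits $\rho_0(0^\pm)$ exist, $p_+(\rho_0(0^+))=p_-(\rho_0(0^-))$ and $\rho_0(0^+)>\rho_0(0^-)$. Write $p'(\rho_0)$ for $p_+'(\rho_0)$ on $(0,l)$ and $p_-'(\rho_0)$ on $(-m,0)$, and $\llbracket f\rrbracket=f(0^+)-f(0^-)$. For $\xi=(\xi_1,\xi_2)\in\mathbb R^2$ and $\lambda>0$, a *normal mode* is a triple $(\varphi,\theta,\psi)$ of real functions on $[-m,l]$, smooth on $(-m,0)$ and on $(0,l)$, with $\psi$ continuous on $[-m,l]$, such that on $(-m,0)\cup(0,l)$ $$\begin{aligned} \lambda^2\rho_0\varphi+\xi_1\,[p'(\rho_0)\rho_0(\xi_1\varphi+\xi_2\theta+\psi')]&=\xi_1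 g\rho_0\psi+2\rho_0\omega\theta,\\ \lambda^2\rho_0\theta+\xi_2\,[p'(\rho_0)\rho_0(\xi_1\varphi+\xi_2\theta+\psi')]&=\xi_2 g\rho_0\psi-2\rho_0\omega\varphi,\\ \lambda^2\rho_0\psi-[p'(\rho_0)\rho_0(\xi_1\varphi+\xi_2\theta+\psi')]'&=g\rho_0(\xi_1\varphi+\xi_2\theta), \end{aligned}$$ with $\llbracket\psi\rrbracket=0$, $\llbracket p'(\rho_0)\rho_0(\xi_1\varphi+\xi_2\theta+\psi')\rrbracket=0$ (in particular these one-sided limits exist), and $\psi(-m)=\psi(l)=0$. For $r,s>0$ let $\mu(r,s)$ be the infimum of $$E(\varphi,\psi)=\frac12\int_{-m}^{l}\Big\{p'(\rho_0)\rho_0(\psi'+r\varphi)^2-2gr\rho_0\psi\varphi+4\omega^2 s\rho_0\varphi^2\Big\}\,dx_3$$ over all $(\varphi,\psi)\in L^2(-m,l)\times H^1_0(-m,l)$ with $\frac12\int_{-m}^{l}\rho_0(\varphi^2+\psi^2)\,dx_3=1$. Call $(R_1,C_0,C_1)$ *admissible* if $R_1\ge 2$, $C_0,C_1>0$ and $\mu(r,s)\le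 -C_0 r+C_1 s$ for all $r\ge R_1$ and all $s>0$. Given an admissible triple, put $$C_2=\max\{4C_1,(R_1C_0/2)^2\},\qquad R_2=2C_0^{-1}\sqrt{C_2},\qquad C_3=C_0/2 .$$ **Theorem 2.2.** Admissible triples $(R_1,C_0,C_1)$ exist (for the given $g,\omega,l,m,p_\pm,\rho_0$). For every admissible triple there are functions $\varphi(\xi,x_3)$, $\theta(\xi,x_3)$, $\psi(\xi,x_3)$ and $\lambda(|\xi|)$ such that: 1. for every $\xi\in\mathbb R^2$ with $|\xi|>R_2$, one has $\lambda=\lambda(|\xi|)>0$ and $-\lambda^2=\mu(|\xi|,\lambda^{-2})$, the triple $(\varphi,\theta,\psi)(\xi,\cdot)$ is a normal mode for $\xi$ and $\lambda$ (so it is smooth on $(-m,0)$ and on $(0,l)$), and $\psi(\xi,0)\ne0$; 2. for every $\xi$ with $|\xi|>R_2$, every $\mathcal R\in SO(2)$ and every $x_3\in[-m,l]$, $$\begin{pmatrix}\varphi(\mathcal R\xi,x_3)\\ \theta(\mathcal R\xi,x_3)\end{pmatrix}=\mathcal R\begin{pmatrix}\varphi(\xi,x_3)\\ \theta(\xi,x_3)\end{pmatrix},\qquad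 \psi(\mathcal R\xi,x_3)=\psi(\xi,x_3);$$ 3. $\lambda(|\xi|)^2\ge C_3|\xi|-1$ for all $\xi$ with $|\xi|>R_2$ and $|\xi|\ge (C_1+1)/C_0$. -/

import Mathlib

open Set Filter Topology MeasureTheory
open scoped ContDiff

/-- A barotropic pressure law on `(0, ∞)`: nonnegative, smooth, strictly increasing, and with
`1 / p'` locally bounded on `(0, ∞)` (that is, `p'` is bounded below by a positive constant on
every compact subset of `(0, ∞)`). -/
structure IsPressureLaw (p : ℝ → ℝ) : Prop where
  nonneg : ∀ z, 0 < z → 0 ≤ p z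
  smooth : ContDiffOn ℝ ∞ p (Ioi 0)
  strictMono : StrictMonoOn p (Ioi 0)
  inv_deriv_bdd : ∀ K : Set ℝ, K ⊆ Ioi 0 → IsCompact K → ∃ c, 0 < c ∧ ∀ z ∈ K, c ≤ deriv p z

/-- The steady density profile `ρ₀` on `(-m, l)`, with upper fluid (pressure law `pp`) in `(0, l)`
and lower fluid (pressure law `pm`) in `(-m, 0)`: `ρ₀` is smooth on each side, bounded above and
below by positive constants, solves `(p(ρ₀))' = -g ρ₀` on each side, the pressure is continuous
across `0`, and the density has a positive jump at `0`. -/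
structure IsSteadyState (g l m : ℝ) (pp pm ρ₀ : ℝ → ℝ) : Prop where
  smooth_lower : ContDiffOn ℝ ∞ ρ₀ (Ioo (-m) 0)
  smooth_upper : ContDiffOn ℝ ∞ ρ₀ (Ioo 0 l)
  bounds : ∃ a b : ℝ, 0 < a ∧ ∀ x ∈ Ioo (-m) 0 ∪ Ioo 0 l, a ≤ ρ₀ x ∧ ρ₀ x ≤ b
  ode_lower : ∀ x ∈ Ioo (-m) 0, deriv (fun y => pm (ρ₀ y)) x = -g * ρ₀ x
  ode_upper : ∀ x ∈ Ioo 0 l, deriv (fun y => pp (ρ₀ y)) x = -g * ρ₀ x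
  jump : ∃ rp rm : ℝ, Tendsto ρ₀ (𝓝[>] 0) (𝓝 rp) ∧ Tendsto ρ₀ (𝓝[<] 0) (𝓝 rm) ∧
    pp rp = pm rm ∧ 0 < rp - rm

/-- The function `p'(ρ₀)`, where `p` is the pressure law of the fluid occupying the height `x`. -/
noncomputable def pressureDeriv (pp pm ρ₀ : ℝ → ℝ) (x : ℝ) : ℝ :=
  if 0 < x then deriv pp (ρ₀ x) else deriv pm (ρ₀ x)

/-- The jump of `f` at `0` vanishes: the two one-sided traces exist and agree. -/
def JumpZero (f : ℝ → ℝ) : Prop :=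
  ∃ a : ℝ, Tendsto f (𝓝[>] 0) (𝓝 a) ∧ Tendsto f (𝓝[<] 0) (𝓝 a)

/-- The quantity `p'(ρ₀) ρ₀ (ξ₁ φ + ξ₂ θ + ψ')`. -/
noncomputable def modeFlux (pp pm ρ₀ : ℝ → ℝ) (ξ : EuclideanSpace ℝ (Fin 2)) (φ θ ψ : ℝ → ℝ)
    (x : ℝ) : ℝ :=
  pressureDeriv pp pm ρ₀ x * ρ₀ x * (ξ 0 * φ x + ξ 1 * θ x + deriv ψ x)

/-- `(φ, θ, ψ)` is smooth on `(-m, 0)` and on `(0, l)`, `ψ` is continuous on `[-m, l]`, and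
`(φ, θ, ψ)` solves the normal mode equations at the horizontal frequency `ξ` with growth rate
`lam` (angular velocity `om`), together with the jump conditions at `0` and the boundary conditions at `-m` and `l`. -/
structure IsNormalMode (g om l m : ℝ) (pp pm ρ₀ : ℝ → ℝ) (ξ : EuclideanSpace ℝ (Fin 2))
    (lam : ℝ) (φ θ ψ : ℝ → ℝ) : Prop where
  smooth_lower : ContDiffOn ℝ ∞ φ (Ioo (-m) 0) ∧ ContDiffOn ℝ ∞ θ (Ioo (-m) 0) ∧
    ContDiffOn ℝ ∞ ψ (Ioo (-m) 0)
  smooth_upper : ContDiffOn ℝ ∞ φ (Ioo 0 l) ∧ ContDiffOn ℝ ∞ θ (Ioo 0 l) ∧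
    ContDiffOn ℝ ∞ ψ (Ioo 0 l)
  continuous : ContinuousOn ψ (Icc (-m) l)
  eq_one : ∀ x ∈ Ioo (-m) 0 ∪ Ioo 0 l,
    lam ^ 2 * ρ₀ x * φ x + ξ 0 * modeFlux pp pm ρ₀ ξ φ θ ψ x
      = ξ 0 * g * ρ₀ x * ψ x + 2 * ρ₀ x * om * θ x
  eq_two : ∀ x ∈ Ioo (-m) 0 ∪ Ioo 0 l,
    lam ^ 2 * ρ₀ x * θ x + ξ 1 * modeFlux pp pm ρ₀ ξ φ θ ψ x
      = ξ 1 * g * ρ₀ x * ψ x - 2 * ρ₀ x * om * φ x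
  eq_three : ∀ x ∈ Ioo (-m) 0 ∪ Ioo 0 l,
    lam ^ 2 * ρ₀ x * ψ x - deriv (modeFlux pp pm ρ₀ ξ φ θ ψ) x
      = g * ρ₀ x * (ξ 0 * φ x + ξ 1 * θ x)
  jump_psi : JumpZero ψ
  jump_flux : JumpZero (modeFlux pp pm ρ₀ ξ φ θ ψ)
  boundary : ψ (-m) = 0 ∧ ψ l = 0

/-- `ψ` (its continuous representative) belongs to `H¹₀(a, b)` and has weak derivative `dψ`:
`dψ ∈ L²(a, b)`, `ψ` is the primitive of `dψ` vanishing at `a`, and `ψ` vanishes at `b`. -/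
structure IsH10 (a b : ℝ) (ψ dψ : ℝ → ℝ) : Prop where
  memLp : MemLp dψ 2 (volume.restrict (Ioo a b))
  primitive : ∀ x ∈ Icc a b, ψ x = ∫ t in a..x, dψ t
  right : ψ b = 0

/-- The energy `E(φ, ψ; s)` at frequency modulus `r = |ξ|`, angular velocity `om`; `dψ` is the weak derivative of `ψ`. -/
noncomputable def energyE (g om l m : ℝ) (pp pm ρ₀ : ℝ → ℝ) (r s : ℝ) (φ ψ dψ : ℝ → ℝ) : ℝ :=
  (1 / 2) * ∫ x in (-m)..l,
    (pressureDeriv pp pm ρ₀ x * ρ₀ x * (dψ x + r * φ x) ^ 2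
      - 2 * g * r * ρ₀ x * ψ x * φ x + 4 * om ^ 2 * s * ρ₀ x * φ x ^ 2)

/-- The constraint functional `J(φ, ψ)`. -/
noncomputable def energyJ (l m : ℝ) (ρ₀ : ℝ → ℝ) (φ ψ : ℝ → ℝ) : ℝ :=
  (1 / 2) * ∫ x in (-m)..l, ρ₀ x * (φ x ^ 2 + ψ x ^ 2)

/-- `μ(s) = inf {E(φ, ψ; s) : φ ∈ L²(-m, l), ψ ∈ H¹₀(-m, l), J(φ, ψ) = 1}` at frequency
modulus `r`. -/
noncomputable def muInf (g om l m : ℝ) (pp pm ρ₀ : ℝ → ℝ) (r s : ℝ) : ℝ :=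
  sInf {e : ℝ | ∃ φ ψ dψ : ℝ → ℝ, MemLp φ 2 (volume.restrict (Ioo (-m) l)) ∧
    IsH10 (-m) l ψ dψ ∧ energyJ l m ρ₀ φ ψ = 1 ∧ e = energyE g om l m pp pm ρ₀ r s φ ψ dψ}

/-- `R₁ ≥ 2` and `C₀, C₁ > 0` are constants, independent of the frequency modulus `r = |ξ|` and
of `s`, for which `μ(s) ≤ -C₀ |ξ| + s C₁` whenever `|ξ| ≥ R₁` and `s > 0`. -/
structure IsEnergyConstants (g om l m : ℝ) (pp pm ρ₀ : ℝ → ℝ) (R₁ C₀ C₁ : ℝ) : Prop where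
  two_le : 2 ≤ R₁
  C₀_pos : 0 < C₀
  C₁_pos : 0 < C₁
  bound : ∀ r s : ℝ, R₁ ≤ r → 0 < s → muInf g om l m pp pm ρ₀ r s ≤ -C₀ * r + s * C₁

/-- `C₂ = max {4 C₁, (R₁ C₀ / 2)²}`. -/
noncomputable def constC2 (R₁ C₀ C₁ : ℝ) : ℝ := max (4 * C₁) ((R₁ * C₀ / 2) ^ 2)

/-- `R₂ = 2 C₀⁻¹ √C₂`. -/
noncomputable def constR2 (R₁ C₀ C₁ : ℝ) : ℝ := 2 * C₀⁻¹ * √(constC2 R₁ C₀ C₁)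

/-- The action `ξ ↦ Q ξ` of a `2 × 2` matrix on horizontal frequencies. -/
noncomputable def rotate (Q : Matrix (Fin 2) (Fin 2) ℝ) (ξ : EuclideanSpace ℝ (Fin 2)) :
    EuclideanSpace ℝ (Fin 2) :=
  WithLp.toLp 2 (Q.mulVec ξ.ofLp)

/-! Put t = λ², s = 1/t, κ = 4ω²s + t and A = p'(ρ)ρ. Since ρ' = -gρ²/A in each layer, the integrand
of 2(E + tJ) equals (gρψ²)' plus the squares A(ψ' + rφ - gρψ/A)² + κρφ² + tρψ². The only negative
contribution to E + tJ is therefore the interface term -½g⟦ρ⟧ψ(0)², and no compactness argument is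
needed to minimise.

In the variables X = ρψ, Y = -κφ/r the Euler-Lagrange equations become X' = αY, Y' = βX with α, β >
0. Along a nonzero solution XY increases strictly, so X cannot vanish at both ends of a layer, and
both layers can be solved with ψ = 0 at the walls and ψ = 1 at the interface
(`StratifiedLayer.exists_layerSolution`). Expanding around ψ(0) times this solution gives E + tJ = ½
D(t) ψ(0)² + (squares of the remainder), where D is the drop of the flux across the interface
(`IsPairSolution.energy_eq`).

If D(t) = 0, then -t is the minimum of E under J = 1 (`muInf_eq_neg`), and flux continuity is the
jump condition of a normal mode (`IsPairSolution.isNormalMode`). A root comes from the intermediate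
value theorem (`exists_fluxDrop_eq_zero`): D < 0 at t₀ = C₀r/2, because admissibility and r > R₂
give μ(r, 1/t₀) < -t₀; D ≥ 0 once t ≥ gr, because then E + tJ ≥ 0. The root satisfies t ≥ C₀r/2,
which is the growth bound.

Admissible constants come from a trial ψ concentrated at scale 1/r near the interface, with φ chosen
to kill the first square: then J is of order 1/r at most, while the interface term stays fixed
(`exists_isEnergyConstants`). -/

/-! ### Absolutely continuous primitives on an interval. -/

/-- `u` is a primitive of the square integrable function `du` on `[a, b]`. -/
structure IsSobolevPrimitive (a b : ℝ) (u du : ℝ → ℝ) : Prop where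
  memLp : MemLp du 2 (volume.restrict (Ioo a b))
  primitive : ∀ x ∈ Icc a b, u x = u a + ∫ t in a..x, du t

theorem MeasureTheory.MemLp.intervalIntegrable_Ioo {a b : ℝ} (hab : a ≤ b) {f : ℝ → ℝ}
    (hf : MemLp f 2 (volume.restrict (Ioo a b))) : IntervalIntegrable f volume a b := by
  rw [intervalIntegrable_iff_integrableOn_Ioo_of_le hab]
  exact hf.integrable (by norm_num)

theorem ContinuousOn.memLp_Ioo {a b : ℝ} {f : ℝ → ℝ} (hf : ContinuousOn f (Icc a b)) :
    MemLp f 2 (volume.restrict (Ioo a b)) := by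
  obtain ⟨C, hC⟩ := isCompact_Icc.exists_bound_of_continuousOn hf
  refine MemLp.of_bound ((hf.mono Ioo_subset_Icc_self).aestronglyMeasurable measurableSet_Ioo) C ?_
  filter_upwards [ae_restrict_mem measurableSet_Ioo] with x hx
  exact hC x (Ioo_subset_Icc_self hx)

theorem intervalIntegrable_continuousOn_mul_mul {a b : ℝ} (hab : a ≤ b) {c f h : ℝ → ℝ}
    (hc : ContinuousOn c (Icc a b)) (hf : MemLp f 2 (volume.restrict (Ioo a b)))
    (hh : MemLp h 2 (volume.restrict (Ioo a b))) :
    IntervalIntegrable (fun x => c x * (f x * h x)) volume a b := by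
  have h1 : IntervalIntegrable (fun x => f x * h x) volume a b := by
    rw [intervalIntegrable_iff_integrableOn_Ioo_of_le hab]
    exact hf.integrable_mul hh
  exact h1.continuousOn_mul (by rwa [uIcc_of_le hab])

theorem AbsolutelyContinuousOnInterval.congr_uIcc {a b : ℝ} {f h : ℝ → ℝ}
    (hf : AbsolutelyContinuousOnInterval f a b) (hfh : EqOn f h (uIcc a b)) :
    AbsolutelyContinuousOnInterval h a b := by
  rw [absolutelyContinuousOnInterval_iff] at hf ⊢
  intro ε hε
  obtain ⟨δ, hδ, H⟩ := hf ε hε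
  refine ⟨δ, hδ, fun E hE hlt => ?_⟩
  refine lt_of_eq_of_lt (Finset.sum_congr rfl fun i hi => ?_) (H E hE hlt)
  rw [hfh (hE.1 i hi).1, hfh (hE.1 i hi).2]

theorem IsSobolevPrimitive.absolutelyContinuousOnInterval {a b : ℝ} (hab : a ≤ b) {u du : ℝ → ℝ}
    (h : IsSobolevPrimitive a b u du) : AbsolutelyContinuousOnInterval u a b := by
  have h1 := (h.memLp.intervalIntegrable_Ioo hab).absolutelyContinuousOnInterval_intervalIntegral
    (c := a) (by simp)
  have h2 : AbsolutelyContinuousOnInterval (fun _ : ℝ => u a) a b :=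
    (LipschitzOnWith.of_dist_le_mul (K := 0) (by simp)).absolutelyContinuousOnInterval
  refine (h2.add h1).congr_uIcc fun x hx => ?_
  rw [uIcc_of_le hab] at hx
  simpa using (h.primitive x hx).symm

theorem IsSobolevPrimitive.ae_hasDerivAt {a b : ℝ} (hab : a ≤ b) {u du : ℝ → ℝ}
    (h : IsSobolevPrimitive a b u du) :
    ∀ᵐ x, x ∈ Ioo a b → HasDerivAt u (du x) x := by
  filter_upwards [(h.memLp.intervalIntegrable_Ioo hab).ae_hasDerivAt_integral] with x hx hxab
  have hx' : x ∈ uIcc a b := by rw [uIcc_of_le hab]; exact Ioo_subset_Icc_self hxab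
  refine ((hx hx' a (by simp)).const_add (u a)).congr_of_eventuallyEq ?_
  filter_upwards [Ioo_mem_nhds hxab.1 hxab.2] with y hy
  exact h.primitive y (Ioo_subset_Icc_self hy)

theorem isSobolevPrimitive_of_hasDerivAt {a b : ℝ} {u du : ℝ → ℝ}
    (hu : ContinuousOn u (Icc a b)) (hdu : ContinuousOn du (Icc a b))
    (h : ∀ x ∈ Ioo a b, HasDerivAt u (du x) x) : IsSobolevPrimitive a b u du := by
  refine ⟨hdu.memLp_Ioo, fun x hx => ?_⟩
  have hsub : Icc a x ⊆ Icc a b := Icc_subset_Icc_right hx.2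
  rw [intervalIntegral.integral_eq_sub_of_hasDerivAt_of_le hx.1 (hu.mono hsub)
    (fun y hy => h y ⟨hy.1, hy.2.trans_le hx.2⟩)]
  · ring
  · exact ContinuousOn.intervalIntegrable (by rw [uIcc_of_le hx.1]; exact hdu.mono hsub)

/-- A test function ψ is only weakly differentiable, so the boundary terms in the energy identity
need the fundamental theorem with an almost everywhere derivative. Integrability of that derivative
is part of the conclusion. -/
theorem AbsolutelyContinuousOnInterval.integral_eq_sub_of_ae_hasDerivAt {a b : ℝ} (hab : a ≤ b)
    {f f' : ℝ → ℝ} (hf : AbsolutelyContinuousOnInterval f a b)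
    (h : ∀ᵐ x, x ∈ Ioo a b → HasDerivAt f (f' x) x) :
    IntervalIntegrable f' volume a b ∧ ∫ x in a..b, f' x = f b - f a := by
  have h1 : ∀ᵐ x, x ∈ uIoc a b → deriv f x = f' x := by
    have hb : ∀ᵐ x : ℝ, x ≠ b := by simp [ae_iff, measure_singleton]
    filter_upwards [h, hb] with x hx hxb hxab
    rw [uIoc_of_le hab] at hxab
    exact (hx ⟨hxab.1, lt_of_le_of_ne hxab.2 hxb⟩).deriv
  refine ⟨hf.intervalIntegrable_deriv.congr_ae ?_, ?_⟩
  · rw [EventuallyEq, ae_restrict_iff' measurableSet_uIoc]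
    exact h1
  · rw [← hf.integral_deriv_eq_sub]
    exact (intervalIntegral.integral_congr_ae h1).symm

/-! ### Planar linear systems through the Prüfer angle. -/

/-- Solutions of `θ' = α cos² θ - β sin² θ` on a compact interval. -/
theorem exists_prueferAngle {α β : ℝ → ℝ} (hα : Continuous α) (hβ : Continuous β) {a b t₀ : ℝ}
    (ht₀ : t₀ ∈ Icc a b) :
    ∃ θ : ℝ → ℝ, θ t₀ = 0 ∧ ∀ x ∈ Icc a b,
      HasDerivWithinAt θ ((α x - β x) / 2 + (α x + β x) / 2 * Real.cos (2 * θ x)) (Icc a b) x := by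
  obtain ⟨M, hM⟩ := (isCompact_Icc (a := a) (b := b)).exists_bound_of_continuousOn
    (hα.continuousOn)
  obtain ⟨N, hN⟩ := (isCompact_Icc (a := a) (b := b)).exists_bound_of_continuousOn
    (hβ.continuousOn)
  have hM0 : 0 ≤ M := (norm_nonneg _).trans (hM t₀ ht₀)
  have hN0 : 0 ≤ N := (norm_nonneg _).trans (hN t₀ ht₀)
  have hmax : 0 ≤ max (b - t₀) (t₀ - a) := le_max_of_le_left (sub_nonneg.2 ht₀.2)
  lift M to NNReal using hM0
  lift N to NNReal using hN0
  obtain ⟨T, hT⟩ : ∃ T : NNReal, (T : ℝ) = max (b - t₀) (t₀ - a) := ⟨⟨_, hmax⟩, rfl⟩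
  -- In double-angle form the field is bounded by M + N and (M + N)-Lipschitz in θ for every θ. A
  -- ball of radius (M + N)T thus contains the solution for the whole interval, and a single
  -- application of Picard-Lindelöf suffices; a linear field is unbounded and would require
  -- continuation.
  let f : ℝ → ℝ → ℝ := fun x θ => (α x - β x) / 2 + (α x + β x) / 2 * Real.cos (2 * θ)
  have hPL : IsPicardLindelof f (⟨t₀, ht₀⟩ : Icc a b) 0
      ((M + N) * T) 0 (M + N) (M + N) := by
    refine ⟨fun x hx => LipschitzOnWith.of_dist_le_mul fun y _ z _ => ?_, fun y _ => ?_,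
      fun x hx y _ => ?_, ?_⟩
    · have h1 : |Real.cos (2 * y) - Real.cos (2 * z)| ≤ 2 * |y - z| := by
        have := Real.abs_cos_sub_cos_le (2 * y) (2 * z)
        rwa [← mul_sub, abs_mul, abs_two] at this
      have h2 : |α x + β x| ≤ M + N := (abs_add_le _ _).trans (add_le_add (hM x hx) (hN x hx))
      have h3 : f x y - f x z
          = (α x + β x) / 2 * (Real.cos (2 * y) - Real.cos (2 * z)) := by
        simp only [f]; ring
      rw [Real.dist_eq, Real.dist_eq, h3, abs_mul, abs_div, abs_two, NNReal.coe_add]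
      calc |α x + β x| / 2 * |Real.cos (2 * y) - Real.cos (2 * z)|
          ≤ (M + N) / 2 * (2 * |y - z|) := by gcongr
        _ = (M + N) * |y - z| := by ring
    · exact Continuous.continuousOn (by simp only [f]; fun_prop)
    · have h1 := abs_le.1 (Real.abs_cos_le_one (2 * y))
      have h2 := abs_le.1 (hM x hx)
      have h3 := abs_le.1 (hN x hx)
      rw [Real.norm_eq_abs, NNReal.coe_add, abs_le]
      have e : f x y = α x * ((1 + Real.cos (2 * y)) / 2) - β x * ((1 - Real.cos (2 * y)) / 2) := by
        simp only [f]; ring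
      rw [e]
      constructor <;> nlinarith
    · simp [hT]
  obtain ⟨θ, h0, h⟩ := hPL.exists_eq_forall_mem_Icc_hasDerivWithinAt₀
  exact ⟨θ, h0, h⟩

/-- The linear system `X' = α Y`, `Y' = β X` on a neighbourhood of `[a, b]`. -/
theorem exists_linear_system_solution {α β : ℝ → ℝ} (hα : Continuous α) (hβ : Continuous β)
    {a b t₀ : ℝ} (ht₀ : t₀ ∈ Icc a b) :
    ∃ X Y : ℝ → ℝ, X t₀ = 0 ∧ (∀ x ∈ Icc a b, HasDerivAt X (α x * Y x) x) ∧
      (∀ x ∈ Icc a b, HasDerivAt Y (β x * X x) x) ∧ ∀ x ∈ Icc a b, 0 < X x ^ 2 + Y x ^ 2 := by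
  -- The enlarged interval makes the derivatives two-sided at a and b.
  have hab : a - 1 ≤ b + 1 := by linarith [ht₀.1, ht₀.2]
  obtain ⟨θ, h0, h⟩ := exists_prueferAngle hα hβ (a := a - 1) (b := b + 1) (t₀ := t₀)
    ⟨by linarith [ht₀.1], by linarith [ht₀.2]⟩
  have hθ : Continuous (IccExtend hab ((Icc (a - 1) (b + 1)).domRestrict θ)) :=
    Continuous.Icc_extend' (continuousOn_iff_continuous_domRestrict.1
      fun x hx => (h x hx).continuousWithinAt)
  set Θ := IccExtend hab ((Icc (a - 1) (b + 1)).domRestrict θ) with hΘ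
  have hΘe : ∀ x ∈ Icc (a - 1) (b + 1), Θ x = θ x := fun x hx => by
    rw [hΘ, IccExtend_of_mem _ _ hx]; rfl
  have hΘ' : ∀ x ∈ Icc a b, HasDerivAt Θ
      ((α x - β x) / 2 + (α x + β x) / 2 * Real.cos (2 * Θ x)) x := fun x hx => by
    have hx' : x ∈ Icc (a - 1) (b + 1) := ⟨by linarith [hx.1], by linarith [hx.2]⟩
    have hn : Icc (a - 1) (b + 1) ∈ 𝓝 x := Icc_mem_nhds (by linarith [hx.1]) (by linarith [hx.2])
    rw [hΘe x hx']
    exact ((h x hx').hasDerivAt hn).congr_of_eventuallyEq (by filter_upwards [hn] using hΘe)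
  -- With X = I sin Θ and Y = I cos Θ, the amplitude must satisfy I' = I(α + β) sin Θ cos Θ. Being
  -- an exponential, it never vanishes, which gives X² + Y² > 0.
  set q : ℝ → ℝ := fun x => (α x + β x) * (Real.sin (Θ x) * Real.cos (Θ x)) with hq
  have hqc : Continuous q := by fun_prop
  set I : ℝ → ℝ := fun x => Real.exp (∫ y in t₀..x, q y) with hI
  have hI' : ∀ x, HasDerivAt I (I x * q x) x := fun x =>
    (hqc.integral_hasStrictDerivAt t₀ x).hasDerivAt.exp
  refine ⟨fun x => I x * Real.sin (Θ x), fun x => I x * Real.cos (Θ x), ?_, fun x hx => ?_,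
    fun x hx => ?_, fun x hx => ?_⟩
  · have : Θ t₀ = 0 := by
      rw [hΘe t₀ ⟨by linarith [ht₀.1], by linarith [ht₀.2]⟩, h0]
    simp [this]
  · refine ((hI' x).mul (hΘ' x hx).sin).congr_deriv ?_
    have h1 := Real.sin_sq_add_cos_sq (Θ x)
    rw [Real.cos_two_mul, hq]
    linear_combination (I x * Real.cos (Θ x) * (α x + β x)) * h1
  · refine ((hI' x).mul (hΘ' x hx).cos).congr_deriv ?_
    have h1 := Real.sin_sq_add_cos_sq (Θ x)
    rw [Real.cos_two_mul, hq]
    ring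
  · have h1 := Real.sin_sq_add_cos_sq (Θ x)
    have : (I x * Real.sin (Θ x)) ^ 2 + (I x * Real.cos (Θ x)) ^ 2 = I x ^ 2 := by
      linear_combination (I x ^ 2) * h1
    simp only [this]
    exact pow_pos (Real.exp_pos _) 2

/-- Bootstrap: each derivative is a smooth coefficient times the other unknown, so one order of
regularity is gained at every step. -/
theorem contDiffOn_linear_system {α β X Y : ℝ → ℝ} {s : Set ℝ} (hs : IsOpen s)
    (hα : ContDiffOn ℝ ∞ α s) (hβ : ContDiffOn ℝ ∞ β s)
    (hX : ∀ x ∈ s, HasDerivAt X (α x * Y x) x) (hY : ∀ x ∈ s, HasDerivAt Y (β x * X x) x) :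
    ContDiffOn ℝ ∞ X s ∧ ContDiffOn ℝ ∞ Y s := by
  have key : ∀ n : ℕ, ContDiffOn ℝ n X s ∧ ContDiffOn ℝ n Y s := by
    intro n
    induction n with
    | zero =>
      simp only [Nat.cast_zero, contDiffOn_zero]
      exact ⟨fun x hx => (hX x hx).continuousAt.continuousWithinAt,
        fun x hx => (hY x hx).continuousAt.continuousWithinAt⟩
    | succ n ih =>
      push_cast
      rw [contDiffOn_succ_iff_deriv_of_isOpen hs, contDiffOn_succ_iff_deriv_of_isOpen hs]
      have hα' : ContDiffOn ℝ n α s := hα.of_le (by exact_mod_cast le_top)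
      have hβ' : ContDiffOn ℝ n β s := hβ.of_le (by exact_mod_cast le_top)
      refine ⟨⟨fun x hx => (hX x hx).differentiableAt.differentiableWithinAt, by simp, ?_⟩,
        ⟨fun x hx => (hY x hx).differentiableAt.differentiableWithinAt, by simp, ?_⟩⟩
      · exact (hα'.mul ih.2).congr fun x hx => (hX x hx).deriv
      · exact (hβ'.mul ih.1).congr fun x hx => (hY x hx).deriv
  exact ⟨contDiffOn_infty.2 fun n => (key n).1, contDiffOn_infty.2 fun n => (key n).2⟩

/-! ### One fluid layer: energy density, Euler-Lagrange system and energy identity. -/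

/-- A single stratified fluid layer on `[a, b]`, with density `ρ` and weight `A = p'(ρ) ρ` extended
to continuous positive functions on the line. -/
structure StratifiedLayer (g a b : ℝ) (ρ A : ℝ → ℝ) : Prop where
  lt : a < b
  continuous_density : Continuous ρ
  continuous_weight : Continuous A
  density_pos : ∀ x, 0 < ρ x
  weight_pos : ∀ x, 0 < A x
  hasDerivAt : ∀ x ∈ Ioo a b, HasDerivAt ρ (-g * ρ x ^ 2 / A x) x
  smooth_density : ContDiffOn ℝ ∞ ρ (Ioo a b)
  smooth_weight : ContDiffOn ℝ ∞ A (Ioo a b)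

/-- The integrand of `2 (E + t J)`, where `κ` is the total coefficient of `ρ φ²`. -/
noncomputable def energyDensity (g r κ t : ℝ) (ρ A φ ψ dψ : ℝ → ℝ) (x : ℝ) : ℝ :=
  A x * (dψ x + r * φ x) ^ 2 - 2 * g * r * ρ x * ψ x * φ x + κ * ρ x * φ x ^ 2
    + t * ρ x * ψ x ^ 2

/-- The energy integrand after completing the square: it differs from `energyDensity` by the
derivative of `g ρ ψ²`. -/
noncomputable def squareDensity (g r κ t : ℝ) (ρ A φ ψ dψ : ℝ → ℝ) (x : ℝ) : ℝ :=
  A x * (dψ x + r * φ x - g * ρ x / A x * ψ x) ^ 2 + κ * ρ x * φ x ^ 2 + t * ρ x * ψ x ^ 2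

/-- The Euler-Lagrange system of the energy in the variables `X = ρ ψ` and `Y = -κ φ / r`. -/
structure IsLayerSolution (r κ t a b : ℝ) (ρ A X Y : ℝ → ℝ) : Prop where
  hasDerivAt_fst : ∀ x ∈ Icc a b, HasDerivAt X ((ρ x ^ 2 / A x + r ^ 2 / κ * ρ x) * Y x) x
  hasDerivAt_snd : ∀ x ∈ Icc a b, HasDerivAt Y (t / ρ x * X x) x

/-- The vertical velocity of a layer solution. -/
noncomputable def layerPsi (ρ X : ℝ → ℝ) (x : ℝ) : ℝ := X x / ρ x

/-- The derivative of the vertical velocity of a layer solution. -/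
noncomputable def layerDPsi (g r κ : ℝ) (ρ A X Y : ℝ → ℝ) (x : ℝ) : ℝ :=
  (ρ x / A x + r ^ 2 / κ) * Y x + g * X x / A x

/-- The radial horizontal velocity of a layer solution. -/
noncomputable def layerPhi (r κ : ℝ) (Y : ℝ → ℝ) (x : ℝ) : ℝ := -(r / κ) * Y x

/-- The flux `A (ψ' + r φ)` of a layer solution. -/
noncomputable def layerFlux (g : ℝ) (ρ X Y : ℝ → ℝ) (x : ℝ) : ℝ := ρ x * Y x + g * X x

namespace StratifiedLayer

variable {g a b : ℝ} {ρ A : ℝ → ℝ}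

theorem isSobolevPrimitive_density (L : StratifiedLayer g a b ρ A) :
    IsSobolevPrimitive a b ρ (fun x => -g * ρ x ^ 2 / A x) := by
  have h1 := L.continuous_density
  have h2 := L.continuous_weight
  refine isSobolevPrimitive_of_hasDerivAt h1.continuousOn (Continuous.continuousOn ?_) L.hasDerivAt
  exact Continuous.div (by fun_prop) h2 fun x => (L.weight_pos x).ne'

theorem intervalIntegrable_energyDensity (L : StratifiedLayer g a b ρ A) (r κ t : ℝ)
    {φ ψ dψ : ℝ → ℝ} (hφ : MemLp φ 2 (volume.restrict (Ioo a b)))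
    (hψ : MemLp ψ 2 (volume.restrict (Ioo a b))) (hdψ : MemLp dψ 2 (volume.restrict (Ioo a b))) :
    IntervalIntegrable (energyDensity g r κ t ρ A φ ψ dψ) volume a b := by
  have h1 := L.continuous_density
  have h2 := L.continuous_weight
  have i1 := intervalIntegrable_continuousOn_mul_mul L.lt.le h2.continuousOn
    (hdψ.add (hφ.const_mul r)) (hdψ.add (hφ.const_mul r))
  have i2 := intervalIntegrable_continuousOn_mul_mul L.lt.le
    (c := fun x => -(2 * g * r * ρ x)) (by fun_prop) hψ hφ
  have i3 := intervalIntegrable_continuousOn_mul_mul L.lt.le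
    (c := fun x => κ * ρ x) (by fun_prop) hφ hφ
  have i4 := intervalIntegrable_continuousOn_mul_mul L.lt.le
    (c := fun x => t * ρ x) (by fun_prop) hψ hψ
  refine (((i1.add i2).add i3).add i4).congr fun x _ => ?_
  simp only [energyDensity, Pi.add_apply]
  ring

theorem intervalIntegrable_squareDensity (L : StratifiedLayer g a b ρ A) (r κ t : ℝ)
    {φ ψ dψ : ℝ → ℝ} (hφ : MemLp φ 2 (volume.restrict (Ioo a b)))
    (hψ : ContinuousOn ψ (Icc a b)) (hdψ : MemLp dψ 2 (volume.restrict (Ioo a b))) :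
    IntervalIntegrable (squareDensity g r κ t ρ A φ ψ dψ) volume a b := by
  have h1 := L.continuous_density
  have h2 := L.continuous_weight
  have h3 : ContinuousOn (fun x => -(g * ρ x / A x * ψ x)) (Icc a b) := by
    refine ContinuousOn.neg (ContinuousOn.mul (Continuous.continuousOn ?_) hψ)
    exact Continuous.div (by fun_prop) h2 fun x => (L.weight_pos x).ne'
  have i0 := (hdψ.add (hφ.const_mul r)).add h3.memLp_Ioo
  have i1 := intervalIntegrable_continuousOn_mul_mul L.lt.le h2.continuousOn i0 i0
  have i3 := intervalIntegrable_continuousOn_mul_mul L.lt.le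
    (c := fun x => κ * ρ x) (by fun_prop) hφ hφ
  have i4 := intervalIntegrable_continuousOn_mul_mul L.lt.le
    (c := fun x => t * ρ x) (by fun_prop) hψ.memLp_Ioo hψ.memLp_Ioo
  refine ((i1.add i3).add i4).congr fun x _ => ?_
  simp only [squareDensity, Pi.add_apply]
  ring

theorem squareDensity_nonneg (L : StratifiedLayer g a b ρ A) {r κ t : ℝ} (hκ : 0 ≤ κ) (ht : 0 ≤ t)
    (φ ψ dψ : ℝ → ℝ) (x : ℝ) : 0 ≤ squareDensity g r κ t ρ A φ ψ dψ x := by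
  have h1 := (L.density_pos x).le
  have h2 := (L.weight_pos x).le
  unfold squareDensity
  positivity

/-- For κ, t ≥ gr the cross term -2grρψφ is absorbed into grρ(ψ - φ)². -/
theorem energyDensity_nonneg (L : StratifiedLayer g a b ρ A) (hg : 0 ≤ g) {r κ t : ℝ} (hr : 0 ≤ r)
    (hκ : g * r ≤ κ) (ht : g * r ≤ t) (φ ψ dψ : ℝ → ℝ) (x : ℝ) :
    0 ≤ energyDensity g r κ t ρ A φ ψ dψ x := by
  have h1 := (L.density_pos x).le
  have h2 := (L.weight_pos x).le
  have e : energyDensity g r κ t ρ A φ ψ dψ x = A x * (dψ x + r * φ x) ^ 2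
      + g * r * ρ x * (ψ x - φ x) ^ 2 + (κ - g * r) * ρ x * φ x ^ 2
      + (t - g * r) * ρ x * ψ x ^ 2 := by
    unfold energyDensity; ring
  have h3 := sub_nonneg.2 hκ
  have h4 := sub_nonneg.2 ht
  rw [e]
  positivity

/-- Shooting from the wall. Since (XY)' = αY² + βX² > 0 along a nonzero solution, X cannot vanish at
both ends; linearity then allows rescaling X to the value ρ at the interface end, that is ψ = 1
there. The two cases place the wall at the left end and at the right end. -/
theorem exists_layerSolution (L : StratifiedLayer g a b ρ A) {r κ t : ℝ} (hκ : 0 < κ) (ht : 0 < t) :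
    (∃ X Y : ℝ → ℝ, IsLayerSolution r κ t a b ρ A X Y ∧ X a = 0 ∧ X b = ρ b) ∧
    ∃ X Y : ℝ → ℝ, IsLayerSolution r κ t a b ρ A X Y ∧ X b = 0 ∧ X a = ρ a := by
  have h1 := L.continuous_density
  have h2 := L.continuous_weight
  have hα : Continuous fun x => ρ x ^ 2 / A x + r ^ 2 / κ * ρ x :=
    (Continuous.div (by fun_prop) h2 fun x => (L.weight_pos x).ne').add (by fun_prop)
  have hβ : Continuous fun x => t / ρ x :=
    Continuous.div continuous_const h1 fun x => (L.density_pos x).ne'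
  have mono : ∀ X Y : ℝ → ℝ, IsLayerSolution r κ t a b ρ A X Y →
      (∀ x ∈ Icc a b, 0 < X x ^ 2 + Y x ^ 2) → X a * Y a < X b * Y b := by
    intro X Y h hpos
    have hder : ∀ x ∈ Icc a b, HasDerivAt (fun x => X x * Y x)
        ((ρ x ^ 2 / A x + r ^ 2 / κ * ρ x) * Y x ^ 2 + t / ρ x * X x ^ 2) x := fun x hx =>
      ((h.hasDerivAt_fst x hx).mul (h.hasDerivAt_snd x hx)).congr_deriv (by ring)
    refine strictMonoOn_of_deriv_pos (convex_Icc a b)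
      (fun x hx => (hder x hx).continuousAt.continuousWithinAt) (fun x hx => ?_)
      (left_mem_Icc.2 L.lt.le) (right_mem_Icc.2 L.lt.le) L.lt
    rw [interior_Icc] at hx
    have hx' := Ioo_subset_Icc_self hx
    rw [(hder x hx').deriv]
    have p1 := L.density_pos x
    have p2 := L.weight_pos x
    have p3 : 0 < ρ x ^ 2 / A x + r ^ 2 / κ * ρ x := by positivity
    have p4 : 0 < t / ρ x := by positivity
    rcases (sq_nonneg (X x)).eq_or_lt' with h0 | h0
    · have : 0 < Y x ^ 2 := by simpa [h0] using hpos x hx'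
      positivity
    · positivity
  have scale : ∀ X Y : ℝ → ℝ, ∀ c : ℝ, IsLayerSolution r κ t a b ρ A X Y →
      IsLayerSolution r κ t a b ρ A (fun x => c * X x) (fun x => c * Y x) := fun X Y c h =>
    ⟨fun x hx => ((h.hasDerivAt_fst x hx).const_mul c).congr_deriv (by ring),
      fun x hx => ((h.hasDerivAt_snd x hx).const_mul c).congr_deriv (by ring)⟩
  constructor
  · obtain ⟨X, Y, h0, hX, hY, hpos⟩ :=
      exists_linear_system_solution hα hβ (left_mem_Icc.2 L.lt.le)
    have hs : IsLayerSolution r κ t a b ρ A X Y := ⟨hX, hY⟩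
    have hne : X b ≠ 0 := fun h => by simpa [h0, h] using mono X Y hs hpos
    exact ⟨_, _, scale X Y (ρ b / X b) hs, by simp [h0], by field_simp⟩
  · obtain ⟨X, Y, h0, hX, hY, hpos⟩ :=
      exists_linear_system_solution hα hβ (right_mem_Icc.2 L.lt.le)
    have hs : IsLayerSolution r κ t a b ρ A X Y := ⟨hX, hY⟩
    have hne : X a ≠ 0 := fun h => by simpa [h0, h] using mono X Y hs hpos
    exact ⟨_, _, scale X Y (ρ a / X a) hs, by simp [h0], by field_simp⟩

end StratifiedLayer

namespace IsLayerSolution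

variable {g r κ t a b : ℝ} {ρ A X Y : ℝ → ℝ}

theorem continuousOn_fst (h : IsLayerSolution r κ t a b ρ A X Y) : ContinuousOn X (Icc a b) :=
  fun x hx => (h.hasDerivAt_fst x hx).continuousAt.continuousWithinAt

theorem continuousOn_snd (h : IsLayerSolution r κ t a b ρ A X Y) : ContinuousOn Y (Icc a b) :=
  fun x hx => (h.hasDerivAt_snd x hx).continuousAt.continuousWithinAt

theorem contDiffOn (h : IsLayerSolution r κ t a b ρ A X Y) (L : StratifiedLayer g a b ρ A) :
    ContDiffOn ℝ ∞ X (Ioo a b) ∧ ContDiffOn ℝ ∞ Y (Ioo a b) := by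
  refine contDiffOn_linear_system isOpen_Ioo ?_ ?_
    (fun x hx => h.hasDerivAt_fst x (Ioo_subset_Icc_self hx))
    (fun x hx => h.hasDerivAt_snd x (Ioo_subset_Icc_self hx))
  · exact ((L.smooth_density.pow 2).div L.smooth_weight fun x _ => (L.weight_pos x).ne').add
      (contDiffOn_const.mul L.smooth_density)
  · exact contDiffOn_const.div L.smooth_density fun x _ => (L.density_pos x).ne'

theorem hasDerivAt_layerPsi (h : IsLayerSolution r κ t a b ρ A X Y)
    (L : StratifiedLayer g a b ρ A) {x : ℝ} (hx : x ∈ Ioo a b) :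
    HasDerivAt (layerPsi ρ X) (layerDPsi g r κ ρ A X Y x) x := by
  have h1 := (L.density_pos x).ne'
  have h2 := (L.weight_pos x).ne'
  refine ((h.hasDerivAt_fst x (Ioo_subset_Icc_self hx)).div (L.hasDerivAt x hx) h1).congr_deriv ?_
  unfold layerDPsi
  field_simp
  ring

/-- This is the third normal mode equation: the right-hand side is tρψ - gρrφ with ψ = X/ρ and φ =
-(r/κ)Y. -/
theorem hasDerivAt_layerFlux (h : IsLayerSolution r κ t a b ρ A X Y)
    (L : StratifiedLayer g a b ρ A) {x : ℝ} (hx : x ∈ Ioo a b) :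
    HasDerivAt (layerFlux g ρ X Y) (t * X x + g * (r ^ 2 / κ) * ρ x * Y x) x := by
  have h1 := (L.density_pos x).ne'
  have h2 := (L.weight_pos x).ne'
  refine (((L.hasDerivAt x hx).mul (h.hasDerivAt_snd x (Ioo_subset_Icc_self hx))).add
    ((h.hasDerivAt_fst x (Ioo_subset_Icc_self hx)).const_mul g)).congr_deriv ?_
  field_simp
  ring

theorem continuousOn_layerPsi (h : IsLayerSolution r κ t a b ρ A X Y)
    (L : StratifiedLayer g a b ρ A) : ContinuousOn (layerPsi ρ X) (Icc a b) :=
  h.continuousOn_fst.div L.continuous_density.continuousOn fun x _ => (L.density_pos x).ne'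

theorem continuousOn_layerFlux (h : IsLayerSolution r κ t a b ρ A X Y)
    (L : StratifiedLayer g a b ρ A) : ContinuousOn (layerFlux g ρ X Y) (Icc a b) :=
  (L.continuous_density.continuousOn.mul h.continuousOn_snd).add
    (continuousOn_const.mul h.continuousOn_fst)

theorem continuousOn_layerDPsi (h : IsLayerSolution r κ t a b ρ A X Y)
    (L : StratifiedLayer g a b ρ A) : ContinuousOn (layerDPsi g r κ ρ A X Y) (Icc a b) := by
  have h1 := L.continuous_density.continuousOn (s := Icc a b)
  have h2 := L.continuous_weight.continuousOn (s := Icc a b)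
  have h3 : ∀ x ∈ Icc a b, A x ≠ 0 := fun x _ => (L.weight_pos x).ne'
  exact (((h1.div h2 h3).add continuousOn_const).mul h.continuousOn_snd).add
    ((continuousOn_const.mul h.continuousOn_fst).div h2 h3)

theorem isSobolevPrimitive_layerPsi (h : IsLayerSolution r κ t a b ρ A X Y)
    (L : StratifiedLayer g a b ρ A) :
    IsSobolevPrimitive a b (layerPsi ρ X) (layerDPsi g r κ ρ A X Y) :=
  isSobolevPrimitive_of_hasDerivAt (h.continuousOn_layerPsi L) (h.continuousOn_layerDPsi L)
    fun _ hx => h.hasDerivAt_layerPsi L hx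

theorem memLp_layerPhi (h : IsLayerSolution r κ t a b ρ A X Y) :
    MemLp (layerPhi r κ Y) 2 (volume.restrict (Ioo a b)) :=
  (continuousOn_const.mul h.continuousOn_snd).memLp_Ioo

/-- Expansion of the energy around a multiple of a solution of the Euler-Lagrange system. -/
theorem integral_energyDensity (h : IsLayerSolution r κ t a b ρ A X Y)
    (L : StratifiedLayer g a b ρ A) (hκ : κ ≠ 0) (c : ℝ) {φ ψ dψ : ℝ → ℝ}
    (hφ : MemLp φ 2 (volume.restrict (Ioo a b))) (hψ : IsSobolevPrimitive a b ψ dψ) :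
    ∃ U : ℝ → ℝ, (∀ x, U x = layerFlux g ρ X Y x * (2 * c * ψ x - c ^ 2 * layerPsi ρ X x)
        + g * ρ x * (ψ x - c * layerPsi ρ X x) ^ 2) ∧
      ∫ x in a..b, energyDensity g r κ t ρ A φ ψ dψ x = U b - U a +
        ∫ x in a..b, squareDensity g r κ t ρ A (fun x => φ x - c * layerPhi r κ Y x)
          (fun x => ψ x - c * layerPsi ρ X x) (fun x => dψ x - c * layerDPsi g r κ ρ A X Y x) x := by
  refine ⟨_, fun x => rfl, ?_⟩
  -- Split ψ = cv + w with v the layer solution. Its flux F contributes c²Fv + 2cFw = F(2cψ - c²v)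
  -- as boundary term; completing the square in w contributes gρw².
  set U : ℝ → ℝ := fun x => layerFlux g ρ X Y x * (2 * c * ψ x - c ^ 2 * layerPsi ρ X x)
        + g * ρ x * (ψ x - c * layerPsi ρ X x) ^ 2 with hU
  have hab := L.lt.le
  have acψ := hψ.absolutelyContinuousOnInterval hab
  have acρ := L.isSobolevPrimitive_density.absolutelyContinuousOnInterval hab
  have acv := (h.isSobolevPrimitive_layerPsi L).absolutelyContinuousOnInterval hab
  have acF : AbsolutelyContinuousOnInterval (layerFlux g ρ X Y) a b := by
    refine (isSobolevPrimitive_of_hasDerivAt (h.continuousOn_layerFlux L) ?_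
      fun _ hx => h.hasDerivAt_layerFlux L hx).absolutelyContinuousOnInterval hab
    exact (continuousOn_const.mul h.continuousOn_fst).add
      ((continuousOn_const.mul L.continuous_density.continuousOn).mul h.continuousOn_snd)
  have achat := acψ.sub (acv.const_mul c)
  have acU : AbsolutelyContinuousOnInterval U a b := by
    refine ((acF.mul ((acψ.const_mul (2 * c)).sub (acv.const_mul (c ^ 2)))).add
      ((acρ.const_mul g).mul (achat.mul achat))).congr_uIcc fun x _ => ?_
    simp only [hU, Pi.add_apply, Pi.mul_apply, Pi.sub_apply]
    ring
  have hψc : ContinuousOn ψ (Icc a b) := by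
    have := acψ.continuousOn; rwa [uIcc_of_le hab] at this
  set S := squareDensity g r κ t ρ A (fun x => φ x - c * layerPhi r κ Y x)
          (fun x => ψ x - c * layerPsi ρ X x) (fun x => dψ x - c * layerDPsi g r κ ρ A X Y x) with hS
  have hSi : IntervalIntegrable S volume a b :=
    L.intervalIntegrable_squareDensity r κ t (hφ.sub (h.memLp_layerPhi.const_mul c))
      (hψc.sub (continuousOn_const.mul (h.continuousOn_layerPsi L)))
      (hψ.memLp.sub ((h.continuousOn_layerDPsi L).memLp_Ioo.const_mul c))
  have hder : ∀ᵐ x, x ∈ Ioo a b →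
      HasDerivAt U (energyDensity g r κ t ρ A φ ψ dψ x - S x) x := by
    filter_upwards [hψ.ae_hasDerivAt hab] with x hx hxab
    have d1 := hx hxab
    have d2 := h.hasDerivAt_layerPsi L hxab
    have d3 := h.hasDerivAt_layerFlux L hxab
    have d4 := L.hasDerivAt x hxab
    refine ((d3.mul ((d1.const_mul (2 * c)).fun_sub (d2.const_mul (c ^ 2)))).add
      ((d4.const_mul g).mul ((d1.fun_sub (d2.const_mul c)).fun_pow 2))).congr_deriv ?_
    have h1 := (L.density_pos x).ne'
    have h2 := (L.weight_pos x).ne'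
    simp only [hS, squareDensity, energyDensity, layerPsi, layerFlux, layerDPsi, layerPhi,
      Nat.cast_ofNat, Nat.add_one_sub_one, pow_one]
    field_simp
    ring
  obtain ⟨hi, he⟩ := acU.integral_eq_sub_of_ae_hasDerivAt hab hder
  have e : ∫ x in a..b, energyDensity g r κ t ρ A φ ψ dψ x =
      ∫ x in a..b, ((energyDensity g r κ t ρ A φ ψ dψ x - S x) + S x) := by simp
  rw [e, intervalIntegral.integral_add hi hSi, he]

end IsLayerSolution

/-! ### From the steady state to two regular layers. -/

theorem IsPressureLaw.deriv_pos {p : ℝ → ℝ} (hp : IsPressureLaw p) {z : ℝ} (hz : 0 < z) :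
    0 < deriv p z := by
  obtain ⟨c, hc, h⟩ := hp.inv_deriv_bdd {z} (by simpa using hz) isCompact_singleton
  exact hc.trans_le (h z rfl)

theorem IsPressureLaw.contDiffOn_deriv {p : ℝ → ℝ} (hp : IsPressureLaw p) :
    ContDiffOn ℝ ∞ (deriv p) (Ioi 0) :=
  ((contDiffOn_infty_iff_deriv_of_isOpen isOpen_Ioi).1 hp.smooth).2

/-- A steady density on an open interval extends to a stratified layer. -/
theorem exists_stratifiedLayer {g a b lo hi : ℝ} (hab : a < b) {p ρ₀ : ℝ → ℝ}
    (hp : IsPressureLaw p) (hs : ContDiffOn ℝ ∞ ρ₀ (Ioo a b)) (hlo : 0 < lo)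
    (hbd : ∀ x ∈ Ioo a b, lo ≤ ρ₀ x ∧ ρ₀ x ≤ hi)
    (hode : ∀ x ∈ Ioo a b, deriv (fun y => p (ρ₀ y)) x = -g * ρ₀ x) :
    ∃ ρ A : ℝ → ℝ, StratifiedLayer g a b ρ A ∧
      ∀ x ∈ Ioo a b, ρ₀ x = ρ x ∧ deriv p (ρ₀ x) * ρ₀ x = A x := by
  obtain ⟨c, hc, hcp⟩ := hp.inv_deriv_bdd (Icc lo hi) (fun z hz => hlo.trans_le hz.1) isCompact_Icc
  have hlohi : lo ≤ hi := by
    have := hbd ((a + b) / 2) ⟨by linarith, by linarith⟩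
    exact this.1.trans this.2
  have hdiff : ∀ x ∈ Ioo a b, DifferentiableAt ℝ ρ₀ x := fun x hx =>
    (hs.differentiableOn (by simp)).differentiableAt (isOpen_Ioo.mem_nhds hx)
  have hmul : ∀ x ∈ Ioo a b, deriv p (ρ₀ x) * deriv ρ₀ x = -g * ρ₀ x := fun x hx => by
    have h0 : 0 < ρ₀ x := hlo.trans_le (hbd x hx).1
    have hpd : DifferentiableAt ℝ p (ρ₀ x) :=
      (hp.smooth.differentiableOn (by simp)).differentiableAt (isOpen_Ioi.mem_nhds h0)
    rw [← hode x hx]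
    exact (hpd.hasDerivAt.comp x (hdiff x hx).hasDerivAt).deriv.symm
  have hder : ∀ x ∈ Ioo a b, deriv ρ₀ x = -g * ρ₀ x ^ 2 / (deriv p (ρ₀ x) * ρ₀ x) := fun x hx => by
    have h0 : 0 < ρ₀ x := hlo.trans_le (hbd x hx).1
    have h1 := hp.deriv_pos h0
    have h2 := hmul x hx
    rw [eq_div_iff (by positivity)]
    linear_combination (ρ₀ x) * h2
  -- The equation reads p'(ρ₀)ρ₀' = -gρ₀; since p' ≥ c on the range of ρ₀, the slope is bounded, and
  -- ρ₀ extends continuously past the ends of the layer.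
  have hlip : LipschitzOnWith (Real.toNNReal (|g| * hi / c)) ρ₀ (Ioo a b) := by
    refine (convex_Ioo a b).lipschitzOnWith_of_nnnorm_deriv_le hdiff fun x hx => ?_
    have h0 := hbd x hx
    have h1 := hcp _ h0
    have h3 : 0 < ρ₀ x := hlo.trans_le h0.1
    have h4 : 0 ≤ hi := hlo.le.trans hlohi
    rw [← NNReal.coe_le_coe, coe_nnnorm, Real.coe_toNNReal _ (by positivity), Real.norm_eq_abs,
      le_div_iff₀ hc]
    calc |deriv ρ₀ x| * c ≤ |deriv ρ₀ x| * deriv p (ρ₀ x) := by gcongr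
      _ = |deriv p (ρ₀ x) * deriv ρ₀ x| := by
        rw [abs_mul, abs_of_pos (hp.deriv_pos h3), mul_comm]
      _ = |g| * ρ₀ x := by rw [hmul x hx, abs_mul, abs_neg, abs_of_pos h3]
      _ ≤ |g| * hi := by gcongr; exact h0.2
  obtain ⟨G, hG, hGe⟩ := hlip.extend_real
  -- Clamping to [lo, hi] keeps the extension positive and leaves it unchanged on the layer.
  set ρ : ℝ → ℝ := fun x => max lo (min hi (G x)) with hρ
  have hρe : ∀ x ∈ Ioo a b, ρ₀ x = ρ x := fun x hx => by
    have h0 := hbd x hx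
    simp only [hρ]
    rw [← hGe hx, min_eq_right h0.2, max_eq_right h0.1]
  have hρpos : ∀ x, 0 < ρ x := fun x => hlo.trans_le (le_max_left _ _)
  have hρc : Continuous ρ := continuous_const.max (continuous_const.min hG.continuous)
  have hρs : ContDiffOn ℝ ∞ ρ (Ioo a b) := hs.congr fun x hx => (hρe x hx).symm
  refine ⟨ρ, fun x => deriv p (ρ x) * ρ x, ⟨hab, hρc, ?_, hρpos,
    fun x => mul_pos (hp.deriv_pos (hρpos x)) (hρpos x), fun x hx => ?_, hρs, ?_⟩, fun x hx => ?_⟩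
  · exact (hp.contDiffOn_deriv.continuousOn.comp_continuous hρc hρpos).mul hρc
  · have h1 := (hdiff x hx).hasDerivAt
    rw [hder x hx, hρe x hx] at h1
    refine h1.congr_of_eventuallyEq ?_
    filter_upwards [isOpen_Ioo.mem_nhds hx] with y hy using (hρe y hy).symm
  · exact (hp.contDiffOn_deriv.comp hρs fun x _ => hρpos x).mul hρs
  · exact ⟨hρe x hx, by rw [hρe x hx]⟩

/-- The two layers of a steady state, with the densities and weights extended continuously. -/
structure StratifiedPair (g l m : ℝ) (pp pm ρ₀ ρm Am ρp Ap : ℝ → ℝ) : Prop where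
  lower : StratifiedLayer g (-m) 0 ρm Am
  upper : StratifiedLayer g 0 l ρp Ap
  eq_lower : ∀ x ∈ Ioo (-m) 0, ρ₀ x = ρm x ∧ pressureDeriv pp pm ρ₀ x * ρ₀ x = Am x
  eq_upper : ∀ x ∈ Ioo 0 l, ρ₀ x = ρp x ∧ pressureDeriv pp pm ρ₀ x * ρ₀ x = Ap x
  jump : ρm 0 < ρp 0

theorem IsSteadyState.exists_stratifiedPair {g l m : ℝ} (hl : 0 < l) (hm : 0 < m)
    {pp pm ρ₀ : ℝ → ℝ} (hpp : IsPressureLaw pp) (hpm : IsPressureLaw pm)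
    (hρ : IsSteadyState g l m pp pm ρ₀) :
    ∃ ρm Am ρp Ap : ℝ → ℝ, StratifiedPair g l m pp pm ρ₀ ρm Am ρp Ap := by
  obtain ⟨lo, hi, hlo, hbd⟩ := hρ.bounds
  obtain ⟨ρm, Am, Lm, em⟩ := exists_stratifiedLayer (neg_lt_zero.2 hm) hpm hρ.smooth_lower hlo
    (fun x hx => hbd x (Or.inl hx)) hρ.ode_lower
  obtain ⟨ρp, Ap, Lp, ep⟩ := exists_stratifiedLayer hl hpp hρ.smooth_upper hlo
    (fun x hx => hbd x (Or.inr hx)) hρ.ode_upper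
  refine ⟨ρm, Am, ρp, Ap, Lm, Lp, fun x hx => ⟨(em x hx).1, ?_⟩, fun x hx => ⟨(ep x hx).1, ?_⟩, ?_⟩
  · rw [← (em x hx).2, pressureDeriv, if_neg hx.2.not_gt]
  · rw [← (ep x hx).2, pressureDeriv, if_pos hx.1]
  · obtain ⟨rp, rm, h1, h2, -, h3⟩ := hρ.jump
    have e1 : ρp 0 = rp := by
      refine tendsto_nhds_unique (Lp.continuous_density.continuousWithinAt (s := Ioi 0)) (h1.congr' ?_)
      filter_upwards [Ioo_mem_nhdsGT hl] with x hx using (ep x hx).1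
    have e2 : ρm 0 = rm := by
      refine tendsto_nhds_unique (Lm.continuous_density.continuousWithinAt (s := Iio 0)) (h2.congr' ?_)
      filter_upwards [Ioo_mem_nhdsLT (neg_lt_zero.2 hm)] with x hx using (em x hx).1
    linarith

/-! ### Gluing across the interface, test pairs and the two-layer energy. -/

/-- The function equal to `f` on `(-∞, 0]` and to `h` on `(0, ∞)`. -/
noncomputable def glue (f h : ℝ → ℝ) (x : ℝ) : ℝ := if x ≤ 0 then f x else h x

theorem glue_of_le {f h : ℝ → ℝ} {x : ℝ} (hx : x ≤ 0) : glue f h x = f x := if_pos hx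

theorem glue_of_gt {f h : ℝ → ℝ} {x : ℝ} (hx : 0 < x) : glue f h x = h x := if_neg hx.not_ge

theorem memLp_glue {l m : ℝ} {f h : ℝ → ℝ} (hf : MemLp f 2 (volume.restrict (Ioo (-m) 0)))
    (hh : MemLp h 2 (volume.restrict (Ioo 0 l))) :
    MemLp (glue f h) 2 (volume.restrict (Ioo (-m) l)) := by
  classical
  have e : glue f h = (Iic (0 : ℝ)).piecewise f h := by
    ext x; simp [glue, Set.piecewise]
  rw [e]
  refine MemLp.piecewise measurableSet_Iic ?_ ?_
  · rw [Measure.restrict_restrict measurableSet_Iic]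
    rw [Measure.restrict_congr_set (Ioo_ae_eq_Ioc (a := -m) (b := (0 : ℝ)))] at hf
    have hsub : Iic 0 ∩ Ioo (-m) l ⊆ Ioc (-m) 0 := fun x hx => ⟨hx.2.1, hx.1⟩
    exact hf.mono_measure (Measure.restrict_mono hsub le_rfl)
  · rw [Measure.restrict_restrict measurableSet_Iic.compl]
    have hsub : (Iic 0)ᶜ ∩ Ioo (-m) l ⊆ Ioo 0 l := fun x hx => ⟨not_le.1 hx.1, hx.2.2⟩
    exact hh.mono_measure (Measure.restrict_mono hsub le_rfl)

theorem isH10_glue {l m : ℝ} (hl : 0 < l) (hm : 0 < m) {f df h dh : ℝ → ℝ}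
    (hf : IsSobolevPrimitive (-m) 0 f df) (hh : IsSobolevPrimitive 0 l h dh)
    (hfm : f (-m) = 0) (h0 : f 0 = h 0) (hhl : h l = 0) :
    IsH10 (-m) l (glue f h) (glue df dh) := by
  have hm' : -m < 0 := neg_lt_zero.2 hm
  have e1 : ∀ x ∈ Icc (-m) 0, ∫ t in (-m)..x, glue df dh t = ∫ t in (-m)..x, df t := fun x hx => by
    refine intervalIntegral.integral_congr fun t ht => ?_
    rw [uIcc_of_le hx.1] at ht
    exact glue_of_le (ht.2.trans hx.2)
  have e2 : ∀ x ∈ Icc 0 l, ∫ t in (0 : ℝ)..x, glue df dh t = ∫ t in (0 : ℝ)..x, dh t :=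
    fun x hx => by
      refine intervalIntegral.integral_congr_ae (ae_of_all _ fun t ht => ?_)
      rw [uIoc_of_le hx.1] at ht
      exact glue_of_gt ht.1
  have hL := memLp_glue (m := m) hf.memLp hh.memLp
  have hi := hL.intervalIntegrable_Ioo (by linarith)
  refine ⟨hL, fun x hx => ?_, ?_⟩
  · rcases le_or_gt x 0 with h | h
    · rw [glue_of_le h, e1 x ⟨hx.1, h⟩, hf.primitive x ⟨hx.1, h⟩, hfm, zero_add]
    · rw [glue_of_gt h, ← intervalIntegral.integral_add_adjacent_intervals (b := 0)
        (hi.mono_set ?_) (hi.mono_set ?_), e1 0 ⟨hm'.le, le_rfl⟩, e2 x ⟨h.le, hx.2⟩,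
        hh.primitive x ⟨h.le, hx.2⟩, ← h0, hf.primitive 0 ⟨hm'.le, le_rfl⟩, hfm, zero_add]
      · rw [uIcc_of_le hm'.le, uIcc_of_le (by linarith)]
        exact Icc_subset_Icc_right hl.le
      · rw [uIcc_of_le h.le, uIcc_of_le (by linarith)]
        exact Icc_subset_Icc hm'.le hx.2
  · rw [glue_of_gt hl, hhl]

theorem IsH10.left {a b : ℝ} (hab : a ≤ b) {ψ dψ : ℝ → ℝ} (h : IsH10 a b ψ dψ) : ψ a = 0 := by
  simpa using h.primitive a ⟨le_rfl, hab⟩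

theorem IsH10.isSobolevPrimitive {a b c d : ℝ} (hac : a ≤ c) (hcd : c ≤ d) (hdb : d ≤ b)
    {ψ dψ : ℝ → ℝ} (h : IsH10 a b ψ dψ) : IsSobolevPrimitive c d ψ dψ := by
  have hi := h.memLp.intervalIntegrable_Ioo (by linarith)
  refine ⟨h.memLp.mono_measure (Measure.restrict_mono_set _ (Ioo_subset_Ioo hac hdb)),
    fun x hx => ?_⟩
  rw [h.primitive x ⟨hac.trans hx.1, hx.2.trans hdb⟩, h.primitive c ⟨hac, hcd.trans hdb⟩,
    intervalIntegral.integral_add_adjacent_intervals (hi.mono_set ?_) (hi.mono_set ?_)]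
  · rw [uIcc_of_le hac, uIcc_of_le (by linarith)]
    exact Icc_subset_Icc_right (hcd.trans hdb)
  · rw [uIcc_of_le hx.1, uIcc_of_le (by linarith)]
    exact Icc_subset_Icc hac (hx.2.trans hdb)

theorem IsSobolevPrimitive.continuousOn {a b : ℝ} (hab : a ≤ b) {u du : ℝ → ℝ}
    (h : IsSobolevPrimitive a b u du) : ContinuousOn u (Icc a b) := by
  have := (h.absolutelyContinuousOnInterval hab).continuousOn
  rwa [uIcc_of_le hab] at this

/-- A pair `(φ, ψ) ∈ L² × H¹₀`, with the weak derivative of `ψ`. -/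
structure IsTestPair (l m : ℝ) (φ ψ dψ : ℝ → ℝ) : Prop where
  memLp : MemLp φ 2 (volume.restrict (Ioo (-m) l))
  isH10 : IsH10 (-m) l ψ dψ

theorem integral_congr_Ioo {a b : ℝ} (hab : a ≤ b) {f h : ℝ → ℝ} (e : ∀ x ∈ Ioo a b, f x = h x) :
    ∫ x in a..b, f x = ∫ x in a..b, h x := by
  rw [intervalIntegral.integral_of_le hab, intervalIntegral.integral_of_le hab,
    integral_Ioc_eq_integral_Ioo, integral_Ioc_eq_integral_Ioo]
  exact setIntegral_congr_fun measurableSet_Ioo e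

theorem intervalIntegrable_congr_Ioo {a b : ℝ} (hab : a ≤ b) {f h : ℝ → ℝ}
    (e : ∀ x ∈ Ioo a b, f x = h x) (hf : IntervalIntegrable f volume a b) :
    IntervalIntegrable h volume a b := by
  rw [intervalIntegrable_iff_integrableOn_Ioo_of_le hab] at hf ⊢
  exact hf.congr_fun e measurableSet_Ioo

namespace IsTestPair

variable {l m : ℝ} {φ ψ dψ : ℝ → ℝ}

theorem memLp_lower (T : IsTestPair l m φ ψ dψ) (hl : 0 ≤ l) :
    MemLp φ 2 (volume.restrict (Ioo (-m) 0)) :=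
  T.memLp.mono_measure (Measure.restrict_mono_set _ (Ioo_subset_Ioo_right hl))

theorem memLp_upper (T : IsTestPair l m φ ψ dψ) (hm : -m ≤ 0) :
    MemLp φ 2 (volume.restrict (Ioo 0 l)) :=
  T.memLp.mono_measure (Measure.restrict_mono_set _ (Ioo_subset_Ioo_left hm))

theorem const_mul (T : IsTestPair l m φ ψ dψ) (c : ℝ) :
    IsTestPair l m (fun x => c * φ x) (fun x => c * ψ x) (fun x => c * dψ x) :=
  ⟨T.memLp.const_mul c, T.isH10.memLp.const_mul c, fun x hx => by
    rw [intervalIntegral.integral_const_mul, T.isH10.primitive x hx], by simp [T.isH10.right]⟩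

end IsTestPair

namespace StratifiedPair

variable {g l m : ℝ} {pp pm ρ₀ ρm Am ρp Ap : ℝ → ℝ} {φ ψ dψ : ℝ → ℝ}

theorem l_pos (P : StratifiedPair g l m pp pm ρ₀ ρm Am ρp Ap) : 0 < l := P.upper.lt

theorem neg_m_neg (P : StratifiedPair g l m pp pm ρ₀ ρm Am ρp Ap) : -m < 0 := P.lower.lt

theorem integral_split (P : StratifiedPair g l m pp pm ρ₀ ρm Am ρp Ap) {f fm fp : ℝ → ℝ}
    (hfm : ∀ x ∈ Ioo (-m) 0, fm x = f x) (hfp : ∀ x ∈ Ioo 0 l, fp x = f x)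
    (im : IntervalIntegrable fm volume (-m) 0) (ip : IntervalIntegrable fp volume 0 l) :
    IntervalIntegrable f volume (-m) l ∧
      ∫ x in (-m)..l, f x = (∫ x in (-m)..0, fm x) + ∫ x in (0 : ℝ)..l, fp x := by
  have im' := intervalIntegrable_congr_Ioo P.neg_m_neg.le hfm im
  have ip' := intervalIntegrable_congr_Ioo P.l_pos.le hfp ip
  refine ⟨im'.trans ip', ?_⟩
  rw [integral_congr_Ioo P.neg_m_neg.le hfm, integral_congr_Ioo P.l_pos.le hfp,
    intervalIntegral.integral_add_adjacent_intervals im' ip']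

/-- With t as multiplier for the constraint J, the rotation term 4ω²s and the φ² part of J merge
into the single coefficient κ = 4ω²s + t. -/
theorem energyE_add_mul_energyJ (P : StratifiedPair g l m pp pm ρ₀ ρm Am ρp Ap)
    (T : IsTestPair l m φ ψ dψ) (om r s t : ℝ) :
    energyE g om l m pp pm ρ₀ r s φ ψ dψ + t * energyJ l m ρ₀ φ ψ =
      1 / 2 * ((∫ x in (-m)..0, energyDensity g r (4 * om ^ 2 * s + t) t ρm Am φ ψ dψ x) +
        ∫ x in (0 : ℝ)..l, energyDensity g r (4 * om ^ 2 * s + t) t ρp Ap φ ψ dψ x) := by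
  have hl := P.l_pos.le
  have hm := P.neg_m_neg.le
  have ψm := T.isH10.isSobolevPrimitive le_rfl hm hl
  have ψp := T.isH10.isSobolevPrimitive hm hl le_rfl
  have i : ∀ κ t, IntervalIntegrable (energyDensity g r κ t ρm Am φ ψ dψ) volume (-m) 0 ∧
      IntervalIntegrable (energyDensity g r κ t ρp Ap φ ψ dψ) volume 0 l := fun κ t =>
    ⟨P.lower.intervalIntegrable_energyDensity r κ t (T.memLp_lower hl)
      (ψm.continuousOn hm).memLp_Ioo ψm.memLp,
     P.upper.intervalIntegrable_energyDensity r κ t (T.memLp_upper hm)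
      (ψp.continuousOn hl).memLp_Ioo ψp.memLp⟩
  obtain ⟨i1, e1⟩ := P.integral_split (f := fun x =>
    (pressureDeriv pp pm ρ₀ x * ρ₀ x * (dψ x + r * φ x) ^ 2
      - 2 * g * r * ρ₀ x * ψ x * φ x + 4 * om ^ 2 * s * ρ₀ x * φ x ^ 2))
    (fun x hx => by
      rw [(P.eq_lower x hx).2, (P.eq_lower x hx).1]; simp [energyDensity])
    (fun x hx => by
      rw [(P.eq_upper x hx).2, (P.eq_upper x hx).1]; simp [energyDensity])
    (i (4 * om ^ 2 * s) 0).1 (i (4 * om ^ 2 * s) 0).2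
  obtain ⟨i2, e2⟩ := P.integral_split (f := fun x =>
    (pressureDeriv pp pm ρ₀ x * ρ₀ x * (dψ x + r * φ x) ^ 2
      - 2 * g * r * ρ₀ x * ψ x * φ x + 4 * om ^ 2 * s * ρ₀ x * φ x ^ 2)
      + t * (ρ₀ x * (φ x ^ 2 + ψ x ^ 2)))
    (fun x hx => by
      rw [(P.eq_lower x hx).2, (P.eq_lower x hx).1]; simp only [energyDensity]; ring)
    (fun x hx => by
      rw [(P.eq_upper x hx).2, (P.eq_upper x hx).1]; simp only [energyDensity]; ring)
    (i (4 * om ^ 2 * s + t) t).1 (i (4 * om ^ 2 * s + t) t).2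
  have i3 : IntervalIntegrable (fun x => t * (ρ₀ x * (φ x ^ 2 + ψ x ^ 2))) volume (-m) l := by
    refine (i2.sub i1).congr fun x _ => ?_
    simp
  rw [← e2, intervalIntegral.integral_add i1 i3, intervalIntegral.integral_const_mul]
  unfold energyE energyJ
  ring

theorem energyE_const_mul (om r s c : ℝ) :
    energyE g om l m pp pm ρ₀ r s (fun x => c * φ x) (fun x => c * ψ x) (fun x => c * dψ x)
      = c ^ 2 * energyE g om l m pp pm ρ₀ r s φ ψ dψ := by
  unfold energyE
  rw [mul_left_comm, ← intervalIntegral.integral_const_mul (c ^ 2)]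
  congr 1
  refine intervalIntegral.integral_congr fun x _ => ?_
  ring

theorem energyJ_const_mul (c : ℝ) :
    energyJ l m ρ₀ (fun x => c * φ x) (fun x => c * ψ x) = c ^ 2 * energyJ l m ρ₀ φ ψ := by
  unfold energyJ
  rw [mul_left_comm, ← intervalIntegral.integral_const_mul (c ^ 2)]
  congr 1
  refine intervalIntegral.integral_congr fun x _ => ?_
  ring

end StratifiedPair

/-! ### Two-layer solutions and the flux drop as a function of t. -/

/-- Solutions of the Euler-Lagrange system in both layers with `ψ = 0` at the rigid boundaries and
`ψ = 1` at the interface. -/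
structure IsPairSolution (r κ t l m : ℝ) (ρm Am ρp Ap Xm Ym Xp Yp : ℝ → ℝ) : Prop where
  lower : IsLayerSolution r κ t (-m) 0 ρm Am Xm Ym
  upper : IsLayerSolution r κ t 0 l ρp Ap Xp Yp
  bottom : Xm (-m) = 0
  interface_lower : Xm 0 = ρm 0
  interface_upper : Xp 0 = ρp 0
  top : Xp l = 0

/-- The flux difference across the interface, lower minus upper. -/
noncomputable def fluxDrop (g : ℝ) (ρm ρp Xm Ym Xp Yp : ℝ → ℝ) : ℝ :=
  layerFlux g ρm Xm Ym 0 - layerFlux g ρp Xp Yp 0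

/-- The sum of the completed squares in both layers. -/
noncomputable def squareEnergy (g r κ t l m : ℝ) (ρm Am ρp Ap φ ψ dψ : ℝ → ℝ) : ℝ :=
  1 / 2 * ((∫ x in (-m)..0, squareDensity g r κ t ρm Am φ ψ dψ x) +
    ∫ x in (0 : ℝ)..l, squareDensity g r κ t ρp Ap φ ψ dψ x)

/-- Exchanging t and t' bounds f(t) from both sides by multiples of f(t') whose factors tend to 1 as
t → t'. -/
theorem continuousOn_of_le_max_div_mul {f : ℝ → ℝ}
    (h : ∀ t t' : ℝ, 0 < t → 0 < t' → f t ≤ max (t / t') (t' / t) * f t') :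
    ContinuousOn f (Ioi 0) := by
  intro t' ht'
  have ht'0 : (0 : ℝ) < t' := ht'
  have hM : Tendsto (fun t => max (t / t') (t' / t)) (𝓝[Ioi 0] t') (𝓝 1) := by
    have : ContinuousWithinAt (fun t => max (t / t') (t' / t)) (Ioi 0) t' := by
      have h1 : ContinuousWithinAt (fun t => t / t') (Ioi 0) t' :=
        (continuous_id.div_const t').continuousWithinAt
      have h2 : ContinuousWithinAt (fun t => t' / t) (Ioi 0) t' :=
        (continuousAt_const.div continuousAt_id ht'0.ne').continuousWithinAt
      exact h1.max h2
    simpa [ContinuousWithinAt, div_self ht'0.ne'] using this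
  have hlow : Tendsto (fun t => (max (t / t') (t' / t))⁻¹ * f t') (𝓝[Ioi 0] t') (𝓝 (f t')) := by
    simpa using (hM.inv₀ one_ne_zero).mul_const (f t')
  have hup : Tendsto (fun t => max (t / t') (t' / t) * f t') (𝓝[Ioi 0] t') (𝓝 (f t')) := by
    simpa using hM.mul_const (f t')
  refine tendsto_of_tendsto_of_tendsto_of_le_of_le' hlow hup ?_ ?_
  · filter_upwards [self_mem_nhdsWithin] with t ht
    have h0 : (0 : ℝ) < t := ht
    have hpos : 0 < max (t / t') (t' / t) := lt_max_of_lt_left (by positivity)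
    rw [inv_mul_le_iff₀ hpos, max_comm]
    exact h t' t ht'0 h0
  · filter_upwards [self_mem_nhdsWithin] with t ht
    exact h t t' ht ht'0

namespace StratifiedPair

variable {g l m : ℝ} {pp pm ρ₀ ρm Am ρp Ap : ℝ → ℝ}

theorem exists_isPairSolution (P : StratifiedPair g l m pp pm ρ₀ ρm Am ρp Ap) {r κ t : ℝ}
    (hκ : 0 < κ) (ht : 0 < t) :
    ∃ Xm Ym Xp Yp : ℝ → ℝ, IsPairSolution r κ t l m ρm Am ρp Ap Xm Ym Xp Yp := by
  obtain ⟨⟨Xm, Ym, hm, h1, h2⟩, -⟩ := P.lower.exists_layerSolution (r := r) hκ ht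
  obtain ⟨-, ⟨Xp, Yp, hp, h3, h4⟩⟩ := P.upper.exists_layerSolution (r := r) hκ ht
  exact ⟨Xm, Ym, Xp, Yp, hm, hp, h1, h2, h4, h3⟩

/-- Used twice: it bounds the energies below, and it fixes the sign of the flux drop for large t. -/
theorem energy_nonneg (P : StratifiedPair g l m pp pm ρ₀ ρm Am ρp Ap) (hg : 0 ≤ g)
    {om r s t : ℝ} (hr : 0 ≤ r) (hs : 0 ≤ s) (ht : g * r ≤ t) {φ ψ dψ : ℝ → ℝ}
    (T : IsTestPair l m φ ψ dψ) :
    0 ≤ energyE g om l m pp pm ρ₀ r s φ ψ dψ + t * energyJ l m ρ₀ φ ψ := by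
  have hκ : g * r ≤ 4 * om ^ 2 * s + t := by nlinarith [mul_nonneg (sq_nonneg om) hs]
  rw [P.energyE_add_mul_energyJ T]
  have h1 := intervalIntegral.integral_nonneg (μ := volume) P.neg_m_neg.le
    fun x _ => P.lower.energyDensity_nonneg hg hr hκ ht φ ψ dψ x
  have h2 := intervalIntegral.integral_nonneg (μ := volume) P.l_pos.le
    fun x _ => P.upper.energyDensity_nonneg hg hr hκ ht φ ψ dψ x
  positivity

end StratifiedPair

namespace IsPairSolution

variable {g r κ t l m : ℝ} {pp pm ρ₀ ρm Am ρp Ap Xm Ym Xp Yp : ℝ → ℝ}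

theorem isTestPair (h : IsPairSolution r κ t l m ρm Am ρp Ap Xm Ym Xp Yp)
    (P : StratifiedPair g l m pp pm ρ₀ ρm Am ρp Ap) :
    IsTestPair l m (glue (layerPhi r κ Ym) (layerPhi r κ Yp)) (glue (layerPsi ρm Xm) (layerPsi ρp Xp))
      (glue (layerDPsi g r κ ρm Am Xm Ym) (layerDPsi g r κ ρp Ap Xp Yp)) := by
  refine ⟨memLp_glue h.lower.memLp_layerPhi h.upper.memLp_layerPhi,
    isH10_glue P.l_pos (neg_lt_zero.1 P.neg_m_neg) (h.lower.isSobolevPrimitive_layerPsi P.lower)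
      (h.upper.isSobolevPrimitive_layerPsi P.upper) ?_ ?_ ?_⟩
  · simp [layerPsi, h.bottom]
  · simp [layerPsi, h.interface_lower, h.interface_upper, (P.lower.density_pos 0).ne',
      (P.upper.density_pos 0).ne']
  · simp [layerPsi, h.top]

theorem glue_layerPsi_zero (h : IsPairSolution r κ t l m ρm Am ρp Ap Xm Ym Xp Yp)
    (P : StratifiedPair g l m pp pm ρ₀ ρm Am ρp Ap) :
    glue (layerPsi ρm Xm) (layerPsi ρp Xp) 0 = 1 := by
  rw [glue_of_le le_rfl, layerPsi, h.interface_lower, div_self (P.lower.density_pos 0).ne']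

/-- The energy of a test pair is the flux term of its trace plus the completed squares of the
remainder. -/
theorem energy_eq (h : IsPairSolution r κ t l m ρm Am ρp Ap Xm Ym Xp Yp)
    (P : StratifiedPair g l m pp pm ρ₀ ρm Am ρp Ap) (hκ : κ ≠ 0) {φ ψ dψ : ℝ → ℝ}
    (T : IsTestPair l m φ ψ dψ) {om s : ℝ} (hs : 4 * om ^ 2 * s + t = κ) :
    energyE g om l m pp pm ρ₀ r s φ ψ dψ + t * energyJ l m ρ₀ φ ψ =
      1 / 2 * fluxDrop g ρm ρp Xm Ym Xp Yp * ψ 0 ^ 2 + 1 / 2 *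
      ((∫ x in (-m)..0, squareDensity g r κ t ρm Am (fun x => φ x - ψ 0 * layerPhi r κ Ym x)
        (fun x => ψ x - ψ 0 * layerPsi ρm Xm x)
        (fun x => dψ x - ψ 0 * layerDPsi g r κ ρm Am Xm Ym x) x) +
      ∫ x in (0 : ℝ)..l, squareDensity g r κ t ρp Ap (fun x => φ x - ψ 0 * layerPhi r κ Yp x)
        (fun x => ψ x - ψ 0 * layerPsi ρp Xp x)
        (fun x => dψ x - ψ 0 * layerDPsi g r κ ρp Ap Xp Yp x) x) := by
  have hl := P.l_pos.le
  have hm := P.neg_m_neg.le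
  obtain ⟨U, hU, e1⟩ := h.lower.integral_energyDensity P.lower hκ (ψ 0) (T.memLp_lower hl)
    (T.isH10.isSobolevPrimitive le_rfl hm hl)
  obtain ⟨V, hV, e2⟩ := h.upper.integral_energyDensity P.upper hκ (ψ 0) (T.memLp_upper hm)
    (T.isH10.isSobolevPrimitive hm hl le_rfl)
  have a1 : layerPsi ρm Xm 0 = 1 := by
    rw [layerPsi, h.interface_lower, div_self (P.lower.density_pos 0).ne']
  have a2 : layerPsi ρp Xp 0 = 1 := by
    rw [layerPsi, h.interface_upper, div_self (P.upper.density_pos 0).ne']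
  have a3 : layerPsi ρm Xm (-m) = 0 := by simp [layerPsi, h.bottom]
  have a4 : layerPsi ρp Xp l = 0 := by simp [layerPsi, h.top]
  have a5 : ψ (-m) = 0 := T.isH10.left (hm.trans hl)
  have b1 : U 0 - U (-m) = layerFlux g ρm Xm Ym 0 * ψ 0 ^ 2 := by
    rw [hU, hU, a1, a3, a5]; ring
  have b2 : V l - V 0 = -layerFlux g ρp Xp Yp 0 * ψ 0 ^ 2 := by
    rw [hV, hV, a2, a4, T.isH10.right]; ring
  rw [P.energyE_add_mul_energyJ T, hs, e1, e2, b1, b2, fluxDrop]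
  ring

/-- The squares of the remainder are dropped, so the sign of the flux drop alone decides whether E +
tJ can be negative. -/
theorem le_energy (h : IsPairSolution r κ t l m ρm Am ρp Ap Xm Ym Xp Yp)
    (P : StratifiedPair g l m pp pm ρ₀ ρm Am ρp Ap) (hκ : 0 < κ) (ht : 0 ≤ t) {φ ψ dψ : ℝ → ℝ}
    (T : IsTestPair l m φ ψ dψ) {om s : ℝ} (hs : 4 * om ^ 2 * s + t = κ) :
    1 / 2 * fluxDrop g ρm ρp Xm Ym Xp Yp * ψ 0 ^ 2 ≤
      energyE g om l m pp pm ρ₀ r s φ ψ dψ + t * energyJ l m ρ₀ φ ψ := by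
  rw [h.energy_eq P hκ.ne' T hs]
  have h1 := intervalIntegral.integral_nonneg (μ := volume) P.neg_m_neg.le
    fun x _ => P.lower.squareDensity_nonneg hκ.le ht (r := r)
      (fun x => φ x - ψ 0 * layerPhi r κ Ym x) (fun x => ψ x - ψ 0 * layerPsi ρm Xm x)
        (fun x => dψ x - ψ 0 * layerDPsi g r κ ρm Am Xm Ym x) x
  have h2 := intervalIntegral.integral_nonneg (μ := volume) P.l_pos.le
    fun x _ => P.upper.squareDensity_nonneg hκ.le ht (r := r)
      (fun x => φ x - ψ 0 * layerPhi r κ Yp x) (fun x => ψ x - ψ 0 * layerPsi ρp Xp x)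
        (fun x => dψ x - ψ 0 * layerDPsi g r κ ρp Ap Xp Yp x) x
  linarith

/-- For the solution itself the trace is 1 and the remainder vanishes, so the lower bound of
`le_energy` is attained. -/
theorem energy_self (h : IsPairSolution r κ t l m ρm Am ρp Ap Xm Ym Xp Yp)
    (P : StratifiedPair g l m pp pm ρ₀ ρm Am ρp Ap) (hκ : 0 < κ) {om s : ℝ}
    (hs : 4 * om ^ 2 * s + t = κ) :
    energyE g om l m pp pm ρ₀ r s (glue (layerPhi r κ Ym) (layerPhi r κ Yp))
      (glue (layerPsi ρm Xm) (layerPsi ρp Xp))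
      (glue (layerDPsi g r κ ρm Am Xm Ym) (layerDPsi g r κ ρp Ap Xp Yp)) +
    t * energyJ l m ρ₀ (glue (layerPhi r κ Ym) (layerPhi r κ Yp))
      (glue (layerPsi ρm Xm) (layerPsi ρp Xp)) = 1 / 2 * fluxDrop g ρm ρp Xm Ym Xp Yp := by
  rw [h.energy_eq P hκ.ne' (h.isTestPair P) hs, h.glue_layerPsi_zero P,
    integral_congr_Ioo P.neg_m_neg.le (h := 0), integral_congr_Ioo P.l_pos.le (h := 0)]
  · simp
  · intro x hx
    simp [squareDensity, glue_of_gt hx.1]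
  · intro x hx
    simp [squareDensity, glue_of_le hx.2.le]

end IsPairSolution

namespace StratifiedPair

variable {g l m : ℝ} {pp pm ρ₀ ρm Am ρp Ap : ℝ → ℝ} {φ ψ dψ : ℝ → ℝ}

/-- Only the trace of `ψ` at the interface contributes negatively to the energy. -/
theorem energy_eq_squareEnergy (P : StratifiedPair g l m pp pm ρ₀ ρm Am ρp Ap)
    (T : IsTestPair l m φ ψ dψ) {om r s t κ : ℝ} (hκ : 0 < κ) (ht : 0 < t)
    (hs : 4 * om ^ 2 * s + t = κ) :
    energyE g om l m pp pm ρ₀ r s φ ψ dψ + t * energyJ l m ρ₀ φ ψ =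
      squareEnergy g r κ t l m ρm Am ρp Ap φ ψ dψ - 1 / 2 * (g * (ρp 0 - ρm 0)) * ψ 0 ^ 2 := by
  obtain ⟨Xm, Ym, Xp, Yp, h⟩ := P.exists_isPairSolution (r := r) hκ ht
  have hl := P.l_pos.le
  have hm := P.neg_m_neg.le
  obtain ⟨U, hU, e1⟩ := h.lower.integral_energyDensity P.lower hκ.ne' 0 (T.memLp_lower hl)
    (T.isH10.isSobolevPrimitive le_rfl hm hl)
  obtain ⟨V, hV, e2⟩ := h.upper.integral_energyDensity P.upper hκ.ne' 0 (T.memLp_upper hm)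
    (T.isH10.isSobolevPrimitive hm hl le_rfl)
  have a5 : ψ (-m) = 0 := T.isH10.left (hm.trans hl)
  simp only [zero_mul, sub_zero, mul_zero, ne_eq, OfNat.ofNat_ne_zero, not_false_eq_true, zero_pow,
    zero_add] at hU hV e1 e2
  rw [P.energyE_add_mul_energyJ T, hs, e1, e2, hU, hU, hV, hV, a5, T.isH10.right, squareEnergy]
  ring

theorem squareEnergy_le_mul (P : StratifiedPair g l m pp pm ρ₀ ρm Am ρp Ap)
    (T : IsTestPair l m φ ψ dψ) {r κ t κ' t' M : ℝ} (hM : 1 ≤ M) (hκ : κ ≤ M * κ')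
    (ht : t ≤ M * t') :
    squareEnergy g r κ t l m ρm Am ρp Ap φ ψ dψ ≤
      M * squareEnergy g r κ' t' l m ρm Am ρp Ap φ ψ dψ := by
  have hl := P.l_pos.le
  have hm := P.neg_m_neg.le
  have ψm := T.isH10.isSobolevPrimitive le_rfl hm hl
  have ψp := T.isH10.isSobolevPrimitive hm hl le_rfl
  have im : ∀ κ t, IntervalIntegrable (squareDensity g r κ t ρm Am φ ψ dψ) volume (-m) 0 :=
    fun κ t => P.lower.intervalIntegrable_squareDensity r κ t (T.memLp_lower hl)
      (ψm.continuousOn hm) ψm.memLp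
  have ip : ∀ κ t, IntervalIntegrable (squareDensity g r κ t ρp Ap φ ψ dψ) volume 0 l :=
    fun κ t => P.upper.intervalIntegrable_squareDensity r κ t (T.memLp_upper hm)
      (ψp.continuousOn hl) ψp.memLp
  have key : ∀ {a b : ℝ} {ρ A : ℝ → ℝ}, StratifiedLayer g a b ρ A → ∀ x,
      squareDensity g r κ t ρ A φ ψ dψ x ≤ M * squareDensity g r κ' t' ρ A φ ψ dψ x := by
    intro a b ρ A L x
    have h1 := L.density_pos x
    have h2 := L.weight_pos x
    have h3 : 0 ≤ A x * (dψ x + r * φ x - g * ρ x / A x * ψ x) ^ 2 := by positivity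
    have h4 : 0 ≤ ρ x * φ x ^ 2 := by positivity
    have h5 : 0 ≤ ρ x * ψ x ^ 2 := by positivity
    have h6 := mul_le_mul_of_nonneg_right hκ h4
    have h7 := mul_le_mul_of_nonneg_right ht h5
    have h8 := mul_le_mul_of_nonneg_right hM h3
    unfold squareDensity
    linarith
  have h1 := intervalIntegral.integral_mono hm (im κ t) ((im κ' t').const_mul M) (key P.lower)
  have h2 := intervalIntegral.integral_mono hl (ip κ t) ((ip κ' t').const_mul M) (key P.upper)
  rw [intervalIntegral.integral_const_mul] at h1 h2
  unfold squareEnergy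
  linarith

/-- The left-hand side is twice the least `squareEnergy` among test pairs with ψ(0) = 1, attained by
the solution for t. The solution for t' serves as competitor, and changing the parameters multiplies
`squareEnergy` by at most M. Both ratios enter because κ contains t as well as 1/t. This yields
continuity in t without any dependence theory for the differential equations. -/
theorem fluxDrop_add_le_mul (P : StratifiedPair g l m pp pm ρ₀ ρm Am ρp Ap)
    {om r t t' : ℝ} (ht : 0 < t) (ht' : 0 < t') {Xm Ym Xp Yp Xm' Ym' Xp' Yp' : ℝ → ℝ}
    (h : IsPairSolution r (4 * om ^ 2 * t⁻¹ + t) t l m ρm Am ρp Ap Xm Ym Xp Yp)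
    (h' : IsPairSolution r (4 * om ^ 2 * t'⁻¹ + t') t' l m ρm Am ρp Ap Xm' Ym' Xp' Yp') :
    fluxDrop g ρm ρp Xm Ym Xp Yp + g * (ρp 0 - ρm 0) ≤
      max (t / t') (t' / t) * (fluxDrop g ρm ρp Xm' Ym' Xp' Yp' + g * (ρp 0 - ρm 0)) := by
  have hκ : 0 < 4 * om ^ 2 * t⁻¹ + t := by positivity
  have hκ' : 0 < 4 * om ^ 2 * t'⁻¹ + t' := by positivity
  have T := h'.isTestPair P
  have e1 := h.le_energy P hκ ht.le T rfl
  have e2 := h'.energy_self P hκ' (om := om) (s := t'⁻¹) rfl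
  rw [P.energy_eq_squareEnergy T hκ ht rfl, h'.glue_layerPsi_zero P] at e1
  rw [P.energy_eq_squareEnergy T hκ' ht' rfl, h'.glue_layerPsi_zero P] at e2
  set M := max (t / t') (t' / t) with hM
  have m1 : t / t' ≤ M := le_max_left _ _
  have m2 : t' / t ≤ M := le_max_right _ _
  have m3 : 1 ≤ M := by
    rcases le_total t t' with h0 | h0
    · exact ((one_le_div ht).2 h0).trans m2
    · exact ((one_le_div ht').2 h0).trans m1
  have m4 : t ≤ M * t' := (div_le_iff₀ ht').1 m1
  have m5 : t⁻¹ ≤ M * t'⁻¹ := by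
    rw [← div_eq_mul_inv, le_div_iff₀ ht', inv_mul_eq_div]; exact m2
  have m6 : 4 * om ^ 2 * t⁻¹ + t ≤ M * (4 * om ^ 2 * t'⁻¹ + t') := by
    nlinarith [mul_le_mul_of_nonneg_left m5 (by positivity : 0 ≤ 4 * om ^ 2)]
  have e3 := P.squareEnergy_le_mul T (r := r) m3 m6 m4
  have e4 := congrArg (fun z => M * z) (eq_add_of_sub_eq e2)
  rw [e4] at e3
  linarith

/-! ### The infimum μ and the root of the flux drop. -/

/-- Since ψ is continuous, ψ(0) ≠ 0 already gives positive mass in the upper layer. -/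
theorem energyJ_pos (P : StratifiedPair g l m pp pm ρ₀ ρm Am ρp Ap)
    (T : IsTestPair l m φ ψ dψ) (h0 : ψ 0 ≠ 0) : 0 < energyJ l m ρ₀ φ ψ := by
  have hl := P.l_pos.le
  have hm := P.neg_m_neg.le
  have ψm := T.isH10.isSobolevPrimitive le_rfl hm hl
  have ψp := T.isH10.isSobolevPrimitive hm hl le_rfl
  have i : ∀ {a b : ℝ} {ρ A : ℝ → ℝ}, StratifiedLayer g a b ρ A →
      MemLp φ 2 (volume.restrict (Ioo a b)) → ContinuousOn ψ (Icc a b) →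
      IntervalIntegrable (fun x => ρ x * ψ x ^ 2) volume a b ∧
      IntervalIntegrable (fun x => ρ x * (φ x ^ 2 + ψ x ^ 2)) volume a b := by
    intro a b ρ A L hφ hψ
    have i1 := intervalIntegrable_continuousOn_mul_mul L.lt.le L.continuous_density.continuousOn
      hψ.memLp_Ioo hψ.memLp_Ioo
    have i2 := intervalIntegrable_continuousOn_mul_mul L.lt.le L.continuous_density.continuousOn
      hφ hφ
    exact ⟨i1.congr fun x _ => by ring, (i2.add i1).congr fun x _ => by ring⟩
  obtain ⟨im1, im2⟩ := i P.lower (T.memLp_lower hl) (ψm.continuousOn hm)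
  obtain ⟨ip1, ip2⟩ := i P.upper (T.memLp_upper hm) (ψp.continuousOn hl)
  have e := (P.integral_split (f := fun x => ρ₀ x * (φ x ^ 2 + ψ x ^ 2))
    (fun x hx => by rw [(P.eq_lower x hx).1]) (fun x hx => by rw [(P.eq_upper x hx).1]) im2 ip2).2
  have h1 : 0 ≤ ∫ x in (-m)..0, ρm x * (φ x ^ 2 + ψ x ^ 2) :=
    intervalIntegral.integral_nonneg hm fun x _ => by
      have := P.lower.density_pos x; positivity
  have h2 : ∫ x in (0 : ℝ)..l, ρp x * ψ x ^ 2 ≤ ∫ x in (0 : ℝ)..l, ρp x * (φ x ^ 2 + ψ x ^ 2) :=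
    intervalIntegral.integral_mono hl ip1 ip2 fun x => by
      have := P.upper.density_pos x
      have := mul_nonneg this.le (sq_nonneg (φ x))
      simp only
      linarith
  have h3 : 0 < ∫ x in (0 : ℝ)..l, ρp x * ψ x ^ 2 := by
    refine intervalIntegral.integral_pos P.l_pos
      (P.upper.continuous_density.continuousOn.mul ((ψp.continuousOn hl).pow 2))
      (fun x _ => ?_) ⟨0, ⟨le_rfl, hl⟩, ?_⟩
    · have := P.upper.density_pos x; positivity
    · have := P.upper.density_pos 0; positivity
  unfold energyJ
  rw [e]
  linarith

theorem energyJ_normalize (hJ : 0 < energyJ l m ρ₀ φ ψ) :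
    energyJ l m ρ₀ (fun x => (√(energyJ l m ρ₀ φ ψ))⁻¹ * φ x)
      (fun x => (√(energyJ l m ρ₀ φ ψ))⁻¹ * ψ x) = 1 := by
  rw [energyJ_const_mul, inv_pow, Real.sq_sqrt hJ.le, inv_mul_cancel₀ (ne_of_gt hJ)]

/-- The set whose infimum is `muInf` is bounded below. -/
theorem bddBelow_energies (P : StratifiedPair g l m pp pm ρ₀ ρm Am ρp Ap) (hg : 0 ≤ g)
    {om r s : ℝ} (hr : 0 ≤ r) (hs : 0 ≤ s) :
    BddBelow {e : ℝ | ∃ φ ψ dψ : ℝ → ℝ, MemLp φ 2 (volume.restrict (Ioo (-m) l)) ∧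
      IsH10 (-m) l ψ dψ ∧ energyJ l m ρ₀ φ ψ = 1 ∧
      e = energyE g om l m pp pm ρ₀ r s φ ψ dψ} := by
  refine ⟨-(g * r), ?_⟩
  rintro e ⟨φ, ψ, dψ, h1, h2, h3, rfl⟩
  have := P.energy_nonneg hg hr hs le_rfl ⟨h1, h2⟩ (om := om)
  rw [h3] at this
  linarith

/-- E and J are both quadratic, so a pair can be normalised by the factor J^(-1/2). -/
theorem muInf_mul_energyJ_le (P : StratifiedPair g l m pp pm ρ₀ ρm Am ρp Ap) (hg : 0 ≤ g)
    {om r s : ℝ} (hr : 0 ≤ r) (hs : 0 ≤ s) (T : IsTestPair l m φ ψ dψ)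
    (hJ : 0 < energyJ l m ρ₀ φ ψ) :
    muInf g om l m pp pm ρ₀ r s * energyJ l m ρ₀ φ ψ ≤ energyE g om l m pp pm ρ₀ r s φ ψ dψ := by
  set J := energyJ l m ρ₀ φ ψ with hJdef
  have T' := T.const_mul (√J)⁻¹
  have hsq : ((√J)⁻¹) ^ 2 = J⁻¹ := by rw [inv_pow, Real.sq_sqrt hJ.le]
  have hle := csInf_le (P.bddBelow_energies (om := om) hg hr hs)
    ⟨_, _, _, T'.memLp, T'.isH10, energyJ_normalize hJ, rfl⟩
  rw [energyE_const_mul, hsq] at hle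
  have := mul_le_mul_of_nonneg_right hle hJ.le
  rwa [mul_right_comm, inv_mul_cancel₀ hJ.ne', one_mul] at this

/-- If the flux is continuous across the interface then `-t` is the minimum of the energy. -/
theorem muInf_eq_neg (P : StratifiedPair g l m pp pm ρ₀ ρm Am ρp Ap) (hg : 0 ≤ g)
    {om r t : ℝ} (hr : 0 ≤ r) (ht : 0 < t) {Xm Ym Xp Yp : ℝ → ℝ}
    (h : IsPairSolution r (4 * om ^ 2 * t⁻¹ + t) t l m ρm Am ρp Ap Xm Ym Xp Yp)
    (h0 : fluxDrop g ρm ρp Xm Ym Xp Yp = 0) : muInf g om l m pp pm ρ₀ r t⁻¹ = -t := by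
  have hκ : 0 < 4 * om ^ 2 * t⁻¹ + t := by positivity
  have T := h.isTestPair P
  have hJ := P.energyJ_pos T (by rw [h.glue_layerPsi_zero P]; exact one_ne_zero)
  have e := h.energy_self P hκ (om := om) (s := t⁻¹) rfl
  rw [h0] at e
  refine le_antisymm ?_ ?_
  · have := P.muInf_mul_energyJ_le hg hr (inv_nonneg.2 ht.le) T hJ (om := om)
    refine le_of_mul_le_mul_right (this.trans_eq ?_) hJ
    linarith
  · refine le_csInf ?_ ?_
    · exact ⟨_, _, _, _, (T.const_mul _).memLp, (T.const_mul _).isH10, energyJ_normalize hJ, rfl⟩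
    · rintro e ⟨φ, ψ, dψ, h1, h2, h3, rfl⟩
      have := h.le_energy P hκ ht.le ⟨h1, h2⟩ (om := om) (s := t⁻¹) rfl
      rw [h0, h3] at this
      linarith

/-- Intermediate value theorem on [t₀, max(t₀, gr)]: a test pair with energy below -t₀ forces a
negative flux drop at t₀, and nonnegativity of E + tJ forces a nonnegative one at the other end. -/
theorem exists_fluxDrop_eq_zero (P : StratifiedPair g l m pp pm ρ₀ ρm Am ρp Ap) (hg : 0 ≤ g)
    {om r t₀ : ℝ} (hr : 0 ≤ r) (ht₀ : 0 < t₀) (hmu : muInf g om l m pp pm ρ₀ r t₀⁻¹ < -t₀) :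
    ∃ t, t₀ ≤ t ∧ ∃ Xm Ym Xp Yp : ℝ → ℝ,
      IsPairSolution r (4 * om ^ 2 * t⁻¹ + t) t l m ρm Am ρp Ap Xm Ym Xp Yp ∧
      fluxDrop g ρm ρp Xm Ym Xp Yp = 0 := by
  have hκ : ∀ t : ℝ, 0 < t → 0 < 4 * om ^ 2 * t⁻¹ + t := fun t ht => by positivity
  have hex : ∀ t : ℝ, 0 < t → ∃ Xm Ym Xp Yp : ℝ → ℝ,
      IsPairSolution r (4 * om ^ 2 * t⁻¹ + t) t l m ρm Am ρp Ap Xm Ym Xp Yp :=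
    fun t ht => P.exists_isPairSolution (hκ t ht) ht
  choose! Xm Ym Xp Yp hsol using hex
  set f : ℝ → ℝ := fun t => fluxDrop g ρm ρp (Xm t) (Ym t) (Xp t) (Yp t) + g * (ρp 0 - ρm 0)
    with hf
  have hcont : ContinuousOn f (Ioi 0) := continuousOn_of_le_max_div_mul fun t t' ht ht' =>
    P.fluxDrop_add_le_mul ht ht' (hsol t ht) (hsol t' ht')
  have hneg : f t₀ ≤ g * (ρp 0 - ρm 0) := by
    -- The infimum of the empty set is 0 by convention, which is incompatible with a value below -t₀
    -- < 0.
    have hne : {e : ℝ | ∃ φ ψ dψ : ℝ → ℝ, MemLp φ 2 (volume.restrict (Ioo (-m) l)) ∧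
        IsH10 (-m) l ψ dψ ∧ energyJ l m ρ₀ φ ψ = 1 ∧
        e = energyE g om l m pp pm ρ₀ r t₀⁻¹ φ ψ dψ}.Nonempty := by
      by_contra hcon
      rw [not_nonempty_iff_eq_empty] at hcon
      rw [muInf, hcon, Real.sInf_empty] at hmu
      linarith
    obtain ⟨e, ⟨φ, ψ, dψ, h1, h2, h3, rfl⟩, hlt⟩ := exists_lt_of_csInf_lt hne hmu
    have hle := (hsol t₀ ht₀).le_energy P (hκ t₀ ht₀) ht₀.le ⟨h1, h2⟩ (om := om) (s := t₀⁻¹) rfl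
    rw [h3] at hle
    by_contra hcon
    have : 0 < fluxDrop g ρm ρp (Xm t₀) (Ym t₀) (Xp t₀) (Yp t₀) := by
      simp only [hf] at hcon; linarith
    have : 0 ≤ 1 / 2 * fluxDrop g ρm ρp (Xm t₀) (Ym t₀) (Xp t₀) (Yp t₀) * ψ 0 ^ 2 := by positivity
    linarith
  set t₁ := max t₀ (g * r) with ht₁
  have ht₁pos : 0 < t₁ := ht₀.trans_le (le_max_left _ _)
  have hpos : g * (ρp 0 - ρm 0) ≤ f t₁ := by
    have e1 := (hsol t₁ ht₁pos).energy_self P (hκ t₁ ht₁pos) (om := om) (s := t₁⁻¹) rfl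
    have e2 := P.energy_nonneg hg hr (inv_nonneg.2 ht₁pos.le) (le_max_right t₀ (g * r)) (om := om)
      ((hsol t₁ ht₁pos).isTestPair P)
    rw [← ht₁, e1] at e2
    simp only [hf]
    linarith
  obtain ⟨t, ht, hft⟩ := intermediate_value_Icc (le_max_left t₀ (g * r))
    (hcont.mono fun x hx => ht₀.trans_le hx.1) ⟨hneg, hpos⟩
  exact ⟨t, ht.1, _, _, _, _, hsol t (ht₀.trans_le ht.1), by simpa [hf] using hft⟩

end StratifiedPair

/-! ### Existence of admissible constants by trial functions. -/

/-- The horizontal velocity that annihilates the stable part of the energy density. -/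
noncomputable def neutralPhi (g r : ℝ) (ρ A ψ dψ : ℝ → ℝ) (x : ℝ) : ℝ :=
  (g * ρ x / A x * ψ x - dψ x) / r

namespace StratifiedLayer

variable {g a b : ℝ} {ρ A : ℝ → ℝ}

theorem continuous_mul_density_div_weight (L : StratifiedLayer g a b ρ A) :
    Continuous fun x => g * ρ x / A x := by
  have h1 := L.continuous_density
  have h2 := L.continuous_weight
  exact Continuous.div (by fun_prop) h2 fun x => (L.weight_pos x).ne'

theorem memLp_neutralPhi (L : StratifiedLayer g a b ρ A) (r : ℝ) {ψ dψ : ℝ → ℝ}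
    (hψ : ContinuousOn ψ (Icc a b)) (hdψ : ContinuousOn dψ (Icc a b)) :
    MemLp (neutralPhi g r ρ A ψ dψ) 2 (volume.restrict (Ioo a b)) :=
  (((L.continuous_mul_density_div_weight.continuousOn.mul hψ).sub hdψ).div_const r).memLp_Ioo

/-- The mass of a profile concentrated at scale `1 / r` is controlled by its envelope `e`. -/
theorem exists_integral_mass_le (L : StratifiedLayer g a b ρ A) {c : ℝ} (hc : 0 ≤ c) :
    ∃ C, 0 < C ∧ ∀ r : ℝ, 1 ≤ r → ∀ e ψ dψ : ℝ → ℝ, ContinuousOn e (Icc a b) →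
      ContinuousOn ψ (Icc a b) → ContinuousOn dψ (Icc a b) →
      (∀ x ∈ Icc a b, |ψ x| ≤ e x ∧ |dψ x| ≤ (c + r) * e x) →
      ∫ x in a..b, ρ x * (neutralPhi g r ρ A ψ dψ x ^ 2 + ψ x ^ 2) ≤ C * ∫ x in a..b, e x ^ 2 := by
  obtain ⟨B, hB⟩ := isCompact_Icc.exists_bound_of_continuousOn
    (L.continuous_density.continuousOn (s := Icc a b))
  obtain ⟨H, hH⟩ := isCompact_Icc.exists_bound_of_continuousOn
    (L.continuous_mul_density_div_weight.continuousOn (s := Icc a b))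
  have hmem : a ∈ Icc a b := ⟨le_rfl, L.lt.le⟩
  have hB0 : 0 < B := by
    refine lt_of_lt_of_le ?_ (hB a hmem)
    rw [norm_pos_iff]
    exact (L.density_pos a).ne'
  have hH0 : 0 ≤ H := (norm_nonneg _).trans (hH a hmem)
  refine ⟨B * ((H + c + 1) ^ 2 + 1), by positivity, fun r hr e ψ dψ he hψ hdψ hbd => ?_⟩
  have hr0 : 0 < r := by linarith
  have hn := ((L.continuous_mul_density_div_weight.continuousOn.mul hψ).sub hdψ).div_const r
  rw [← intervalIntegral.integral_const_mul]
  refine intervalIntegral.integral_mono_on L.lt.le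
    (ContinuousOn.intervalIntegrable ?_) (ContinuousOn.intervalIntegrable ?_) fun x hx => ?_
  · rw [uIcc_of_le L.lt.le]
    exact L.continuous_density.continuousOn.mul ((hn.pow 2).add (hψ.pow 2))
  · rw [uIcc_of_le L.lt.le]
    exact continuousOn_const.mul (he.pow 2)
  · obtain ⟨h1, h2⟩ := hbd x hx
    have he0 : 0 ≤ e x := (abs_nonneg _).trans h1
    have h3 : ρ x ≤ B := (le_abs_self _).trans (hB x hx)
    have h4 : |g * ρ x / A x| ≤ H := hH x hx
    -- The derivative has size r·e, and the division by r in `neutralPhi` compensates for it; r ≥ 1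
    -- makes the bound uniform in r.
    have h5 : |neutralPhi g r ρ A ψ dψ x| ≤ (H + c + 1) * e x := by
      rw [neutralPhi, abs_div, abs_of_pos hr0, div_le_iff₀ hr0]
      calc |g * ρ x / A x * ψ x - dψ x| ≤ |g * ρ x / A x * ψ x| + |dψ x| := abs_sub _ _
        _ ≤ H * e x + (c + r) * e x := by rw [abs_mul]; gcongr
        _ = (H + c) * e x * 1 + r * e x := by ring
        _ ≤ (H + c) * e x * r + r * e x := by gcongr
        _ = (H + c + 1) * e x * r := by ring
    have h6 : neutralPhi g r ρ A ψ dψ x ^ 2 ≤ ((H + c + 1) * e x) ^ 2 := by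
      rw [← sq_abs]; gcongr
    have h7 : ψ x ^ 2 ≤ e x ^ 2 := by rw [← sq_abs]; gcongr
    calc ρ x * (neutralPhi g r ρ A ψ dψ x ^ 2 + ψ x ^ 2)
        ≤ B * (((H + c + 1) * e x) ^ 2 + e x ^ 2) := by
          have := (L.density_pos x).le; gcongr
      _ = B * ((H + c + 1) ^ 2 + 1) * e x ^ 2 := by ring

end StratifiedLayer

theorem integral_exp_neg_sq_le {r l : ℝ} (hr : 0 < r) :
    ∫ x in (0 : ℝ)..l, Real.exp (-r * x) ^ 2 ≤ 1 / (2 * r) := by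
  have hd : ∀ x ∈ uIcc 0 l, HasDerivAt (fun x => -Real.exp (-(2 * r) * x) / (2 * r))
      (Real.exp (-r * x) ^ 2) x := fun x _ => by
    refine ((((hasDerivAt_id x).const_mul (-(2 * r))).exp.neg).div_const (2 * r)).congr_deriv ?_
    rw [← Real.exp_nat_mul]
    simp only [id]
    field_simp
    congr 1
    push_cast
    ring
  rw [intervalIntegral.integral_eq_sub_of_hasDerivAt hd
    (Continuous.intervalIntegrable (by fun_prop) _ _), ← sub_div]
  gcongr
  have := Real.exp_pos (-(2 * r) * l)
  simp only [mul_zero, Real.exp_zero]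
  linarith

theorem integral_exp_sq_le {r m : ℝ} (hr : 0 < r) :
    ∫ x in (-m)..0, Real.exp (r * x) ^ 2 ≤ 1 / (2 * r) := by
  have h := integral_exp_neg_sq_le (l := m) hr
  have e := intervalIntegral.integral_comp_neg (a := 0) (b := m)
    (fun x => Real.exp (r * x) ^ 2)
  rw [neg_zero] at e
  rw [← e]
  simpa using h

namespace StratifiedPair

variable {g l m : ℝ} {pp pm ρ₀ ρm Am ρp Ap : ℝ → ℝ}

/-- When the first square vanishes, what remains of the squares is at most κJ, and the interface
term supplies the negative part. -/
theorem energyE_le_of_neutral (P : StratifiedPair g l m pp pm ρ₀ ρm Am ρp Ap) {ψ dψ φ : ℝ → ℝ}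
    (T : IsTestPair l m φ ψ dψ) {om r s : ℝ} (hs : 0 ≤ s)
    (hm : ∀ x ∈ Ioo (-m) 0, dψ x + r * φ x - g * ρm x / Am x * ψ x = 0)
    (hp : ∀ x ∈ Ioo 0 l, dψ x + r * φ x - g * ρp x / Ap x * ψ x = 0)
    (im : IntervalIntegrable (fun x => ρm x * (φ x ^ 2 + ψ x ^ 2)) volume (-m) 0)
    (ip : IntervalIntegrable (fun x => ρp x * (φ x ^ 2 + ψ x ^ 2)) volume 0 l) :
    energyE g om l m pp pm ρ₀ r s φ ψ dψ ≤ 4 * om ^ 2 * s * energyJ l m ρ₀ φ ψ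
      - 1 / 2 * (g * (ρp 0 - ρm 0)) * ψ 0 ^ 2 := by
  -- The multiplier t = 1 is an arbitrary positive choice; the term tJ cancels at the end.
  have hκ : 0 < 4 * om ^ 2 * s + 1 := by positivity
  have e1 := P.energy_eq_squareEnergy T (r := r) hκ one_pos rfl
  have e2 : energyJ l m ρ₀ φ ψ = 1 / 2 * ((∫ x in (-m)..0, ρm x * (φ x ^ 2 + ψ x ^ 2)) +
      ∫ x in (0 : ℝ)..l, ρp x * (φ x ^ 2 + ψ x ^ 2)) := by
    rw [energyJ, (P.integral_split (fun x hx => by rw [(P.eq_lower x hx).1])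
      (fun x hx => by rw [(P.eq_upper x hx).1]) im ip).2]
  have key : ∀ {a b : ℝ} {ρ A : ℝ → ℝ}, StratifiedLayer g a b ρ A →
      MemLp φ 2 (volume.restrict (Ioo a b)) → IsSobolevPrimitive a b ψ dψ →
      (∀ x ∈ Ioo a b, dψ x + r * φ x - g * ρ x / A x * ψ x = 0) →
      IntervalIntegrable (fun x => ρ x * (φ x ^ 2 + ψ x ^ 2)) volume a b →
      ∫ x in a..b, squareDensity g r (4 * om ^ 2 * s + 1) 1 ρ A φ ψ dψ x ≤
        (4 * om ^ 2 * s + 1) * ∫ x in a..b, ρ x * (φ x ^ 2 + ψ x ^ 2) := by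
    intro a b ρ A L hφ hψ h0 hi
    rw [← intervalIntegral.integral_const_mul]
    refine intervalIntegral.integral_mono_on_of_le_Ioo L.lt.le
      (L.intervalIntegrable_squareDensity _ _ _ hφ (hψ.continuousOn L.lt.le) hψ.memLp)
      (hi.const_mul _) fun x hx => ?_
    have h1 := L.density_pos x
    have h2 : 0 ≤ 4 * om ^ 2 * s * (ρ x * ψ x ^ 2) := by positivity
    rw [squareDensity, h0 x hx]
    linarith
  have hl' := P.l_pos.le
  have hm' := P.neg_m_neg.le
  have k1 := key P.lower (T.memLp_lower hl') (T.isH10.isSobolevPrimitive le_rfl hm' hl') hm im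
  have k2 := key P.upper (T.memLp_upper hm') (T.isH10.isSobolevPrimitive hm' hl' le_rfl) hp ip
  rw [squareEnergy] at e1
  rw [e2] at e1 ⊢
  linarith

theorem exists_isEnergyConstants (P : StratifiedPair g l m pp pm ρ₀ ρm Am ρp Ap) (hg : 0 < g)
    (om : ℝ) : ∃ R₁ C₀ C₁ : ℝ, IsEnergyConstants g om l m pp pm ρ₀ R₁ C₀ C₁ := by
  have hl := P.l_pos
  have hm : 0 < m := neg_lt_zero.1 P.neg_m_neg
  obtain ⟨Cm, hCm, bm⟩ := P.lower.exists_integral_mass_le (c := 1 / m) (by positivity)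
  obtain ⟨Cp, hCp, bp⟩ := P.upper.exists_integral_mass_le (c := 1 / l) (by positivity)
  have hG : 0 < g * (ρp 0 - ρm 0) := mul_pos hg (sub_pos.2 P.jump)
  -- With J ≤ (Cm + Cp)/(4r), this C₀ gives C₀rJ ≤ ½g⟦ρ⟧, exactly the gain at the interface. The
  -- summand 1 in C₁ keeps it positive when ω = 0.
  refine ⟨2, 2 * (g * (ρp 0 - ρm 0)) / (Cm + Cp), 4 * om ^ 2 + 1, le_rfl, by positivity,
    by positivity, fun r s hr hs => ?_⟩
  have hr0 : 0 < r := by linarith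
  -- Exponentials decaying away from the interface at rate r, cut off by affine factors so that they
  -- vanish at the walls and equal 1 at the interface.
  set um : ℝ → ℝ := fun x => (1 + x / m) * Real.exp (r * x) with hum
  set dum : ℝ → ℝ := fun x => (1 / m + r * (1 + x / m)) * Real.exp (r * x) with hdum
  set up : ℝ → ℝ := fun x => (1 - x / l) * Real.exp (-r * x) with hup
  set dup : ℝ → ℝ := fun x => (-(1 / l) - r * (1 - x / l)) * Real.exp (-r * x) with hdup
  have cum : Continuous um := by fun_prop
  have cdum : Continuous dum := by fun_prop
  have cup : Continuous up := by fun_prop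
  have cdup : Continuous dup := by fun_prop
  have prm : IsSobolevPrimitive (-m) 0 um dum :=
    isSobolevPrimitive_of_hasDerivAt cum.continuousOn cdum.continuousOn fun x _ => by
      refine ((((hasDerivAt_id x).div_const m).const_add 1).mul
        ((hasDerivAt_id x).const_mul r).exp).congr_deriv ?_
      simp only [hdum, id]
      ring
  have prp : IsSobolevPrimitive 0 l up dup :=
    isSobolevPrimitive_of_hasDerivAt cup.continuousOn cdup.continuousOn fun x _ => by
      refine ((((hasDerivAt_id x).div_const l).const_sub 1).mul
        ((hasDerivAt_id x).const_mul (-r)).exp).congr_deriv ?_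
      simp only [hdup, id]
      ring
  set vm := neutralPhi g r ρm Am um dum with hvm
  set vp := neutralPhi g r ρp Ap up dup with hvp
  have mvm : MemLp vm 2 (volume.restrict (Ioo (-m) 0)) :=
    P.lower.memLp_neutralPhi r cum.continuousOn cdum.continuousOn
  have mvp : MemLp vp 2 (volume.restrict (Ioo 0 l)) :=
    P.upper.memLp_neutralPhi r cup.continuousOn cdup.continuousOn
  have T : IsTestPair l m (glue vm vp) (glue um up) (glue dum dup) :=
    ⟨memLp_glue mvm mvp, isH10_glue hl hm prm prp (by simp [hum, hm.ne'])
      (by simp [hum, hup]) (by simp [hup, hl.ne'])⟩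
  have hψ0 : glue um up 0 = 1 := by rw [glue_of_le le_rfl]; simp [hum]
  have jm := bm r (by linarith) (fun x => Real.exp (r * x)) um dum (by fun_prop) cum.continuousOn
    cdum.continuousOn fun x hx => by
      have h1 : 0 ≤ 1 + x / m := by
        have := (div_le_div_iff_of_pos_right hm).2 hx.1
        rw [neg_div, div_self hm.ne'] at this; linarith
      have h2 : x / m ≤ 0 := div_nonpos_of_nonpos_of_nonneg hx.2 hm.le
      have h3 := Real.exp_pos (r * x)
      simp only [hum, hdum]
      rw [abs_of_nonneg (by positivity), abs_of_nonneg (by positivity)]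
      constructor
      · nlinarith
      · gcongr; nlinarith
  have jp := bp r (by linarith) (fun x => Real.exp (-r * x)) up dup (by fun_prop) cup.continuousOn
    cdup.continuousOn fun x hx => by
      have h1 : 0 ≤ 1 - x / l := by
        have := (div_le_one hl).2 hx.2; linarith
      have h2 : 0 ≤ x / l := div_nonneg hx.1 hl.le
      have h3 := Real.exp_pos (-r * x)
      have h4 : |(-(1 / l) - r * (1 - x / l)) * Real.exp (-r * x)|
          = (1 / l + r * (1 - x / l)) * Real.exp (-r * x) := by
        rw [← abs_neg, show -((-(1 / l) - r * (1 - x / l)) * Real.exp (-r * x))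
          = (1 / l + r * (1 - x / l)) * Real.exp (-r * x) by ring]
        exact abs_of_nonneg (by positivity)
      simp only [hup, hdup]
      rw [abs_of_nonneg (by positivity), h4]
      constructor
      · nlinarith
      · gcongr; nlinarith
  have im : IntervalIntegrable (fun x => ρm x * (vm x ^ 2 + um x ^ 2)) volume (-m) 0 :=
    ((intervalIntegrable_continuousOn_mul_mul P.neg_m_neg.le
      P.lower.continuous_density.continuousOn mvm mvm).add
    (intervalIntegrable_continuousOn_mul_mul P.neg_m_neg.le
      P.lower.continuous_density.continuousOn cum.continuousOn.memLp_Ioo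
      cum.continuousOn.memLp_Ioo)).congr fun x _ => by ring
  have ip : IntervalIntegrable (fun x => ρp x * (vp x ^ 2 + up x ^ 2)) volume 0 l :=
    ((intervalIntegrable_continuousOn_mul_mul hl.le
      P.upper.continuous_density.continuousOn mvp mvp).add
    (intervalIntegrable_continuousOn_mul_mul hl.le
      P.upper.continuous_density.continuousOn cup.continuousOn.memLp_Ioo
      cup.continuousOn.memLp_Ioo)).congr fun x _ => by ring
  have hJle : energyJ l m ρ₀ (glue vm vp) (glue um up) ≤ (Cm + Cp) / (4 * r) := by
    have e := (P.integral_split (f := fun x => ρ₀ x * (glue vm vp x ^ 2 + glue um up x ^ 2))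
      (fun x hx => by rw [(P.eq_lower x hx).1, glue_of_le hx.2.le, glue_of_le hx.2.le])
      (fun x hx => by rw [(P.eq_upper x hx).1, glue_of_gt hx.1, glue_of_gt hx.1]) im ip).2
    have k1 := mul_le_mul_of_nonneg_left (integral_exp_sq_le (m := m) hr0) hCm.le
    have k2 := mul_le_mul_of_nonneg_left (integral_exp_neg_sq_le (l := l) hr0) hCp.le
    have k3 : (Cm + Cp) / (4 * r) = 1 / 2 * (Cm * (1 / (2 * r)) + Cp * (1 / (2 * r))) := by
      field_simp; ring
    rw [energyJ, e, k3]
    linarith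
  have hJ := P.energyJ_pos T (by rw [hψ0]; exact one_ne_zero)
  have hE := P.energyE_le_of_neutral T (om := om) (r := r) hs.le
    (fun x hx => by
      rw [glue_of_le hx.2.le, glue_of_le hx.2.le, glue_of_le hx.2.le, hvm, neutralPhi]
      field_simp; ring)
    (fun x hx => by
      rw [glue_of_gt hx.1, glue_of_gt hx.1, glue_of_gt hx.1, hvp, neutralPhi]
      field_simp; ring)
    (intervalIntegrable_congr_Ioo P.neg_m_neg.le
      (fun x hx => by rw [glue_of_le hx.2.le, glue_of_le hx.2.le]) im)
    (intervalIntegrable_congr_Ioo hl.le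
      (fun x hx => by rw [glue_of_gt hx.1, glue_of_gt hx.1]) ip)
  rw [hψ0] at hE
  have hmu := P.muInf_mul_energyJ_le hg.le hr0.le hs.le T hJ (om := om)
  set J := energyJ l m ρ₀ (glue vm vp) (glue um up)
  refine le_of_mul_le_mul_right (hmu.trans (hE.trans ?_)) hJ
  have h1 : 2 * (g * (ρp 0 - ρm 0)) / (Cm + Cp) * r * J ≤ 1 / 2 * (g * (ρp 0 - ρm 0)) := by
    calc 2 * (g * (ρp 0 - ρm 0)) / (Cm + Cp) * r * J
        ≤ 2 * (g * (ρp 0 - ρm 0)) / (Cm + Cp) * r * ((Cm + Cp) / (4 * r)) := by gcongr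
      _ = 1 / 2 * (g * (ρp 0 - ρm 0)) := by field_simp; ring
  have h2 : 0 ≤ s * J := by positivity
  linarith

end StratifiedPair

/-! ### Normal modes for a vector frequency, and rotations. -/

/-- In one layer, a solution of the Euler-Lagrange system for `|ξ|` gives a solution of the normal
mode equations for `ξ`. -/
theorem IsLayerSolution.normalMode {g om r t a b lam : ℝ} {ρ A X Y pp pm ρ₀ φ θ ψ : ℝ → ℝ}
    {ξ : EuclideanSpace ℝ (Fin 2)}
    (h : IsLayerSolution r (4 * om ^ 2 * t⁻¹ + t) t a b ρ A X Y) (L : StratifiedLayer g a b ρ A)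
    (ht : 0 < t) (hlam : lam ^ 2 = t) (hξ : ξ 0 ^ 2 + ξ 1 ^ 2 = r ^ 2)
    (hρ : ∀ x ∈ Ioo a b, ρ₀ x = ρ x ∧ pressureDeriv pp pm ρ₀ x * ρ₀ x = A x)
    (hφ : ∀ x ∈ Ioo a b, φ x = -(t * ξ 0 + 2 * om * ξ 1) / (t ^ 2 + 4 * om ^ 2) * Y x)
    (hθ : ∀ x ∈ Ioo a b, θ x = -(t * ξ 1 - 2 * om * ξ 0) / (t ^ 2 + 4 * om ^ 2) * Y x)
    (hψ : ∀ x ∈ Ioo a b, ψ x = layerPsi ρ X x) :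
    (ContDiffOn ℝ ∞ φ (Ioo a b) ∧ ContDiffOn ℝ ∞ θ (Ioo a b) ∧ ContDiffOn ℝ ∞ ψ (Ioo a b)) ∧
    (∀ x ∈ Ioo a b, modeFlux pp pm ρ₀ ξ φ θ ψ x = layerFlux g ρ X Y x) ∧
    ∀ x ∈ Ioo a b,
      lam ^ 2 * ρ₀ x * φ x + ξ 0 * modeFlux pp pm ρ₀ ξ φ θ ψ x
        = ξ 0 * g * ρ₀ x * ψ x + 2 * ρ₀ x * om * θ x ∧
      lam ^ 2 * ρ₀ x * θ x + ξ 1 * modeFlux pp pm ρ₀ ξ φ θ ψ x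
        = ξ 1 * g * ρ₀ x * ψ x - 2 * ρ₀ x * om * φ x ∧
      lam ^ 2 * ρ₀ x * ψ x - deriv (modeFlux pp pm ρ₀ ξ φ θ ψ) x
        = g * ρ₀ x * (ξ 0 * φ x + ξ 1 * θ x) := by
  have hΔ : 0 < t ^ 2 + 4 * om ^ 2 := by positivity
  -- The choice s = 1/t makes the radial part of the velocity solving the rotating system coincide
  -- with r times `layerPhi`.
  have hκ : r ^ 2 / (4 * om ^ 2 * t⁻¹ + t) = t * r ^ 2 / (t ^ 2 + 4 * om ^ 2) := by
    field_simp
    ring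
  have hrad : ∀ x ∈ Ioo a b, ξ 0 * φ x + ξ 1 * θ x
      = -(r ^ 2 / (4 * om ^ 2 * t⁻¹ + t)) * Y x := fun x hx => by
    rw [hφ x hx, hθ x hx, hκ, ← hξ]
    field_simp
    ring
  have hflux : ∀ x ∈ Ioo a b, modeFlux pp pm ρ₀ ξ φ θ ψ x = layerFlux g ρ X Y x := fun x hx => by
    have hd : deriv ψ x = layerDPsi g r (4 * om ^ 2 * t⁻¹ + t) ρ A X Y x := by
      refine ((h.hasDerivAt_layerPsi L hx).congr_of_eventuallyEq ?_).deriv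
      filter_upwards [Ioo_mem_nhds hx.1 hx.2] with y hy using hψ y hy
    have hA := (L.weight_pos x).ne'
    rw [modeFlux, (hρ x hx).2, hrad x hx, hd, layerDPsi, layerFlux]
    field_simp
    ring
  obtain ⟨sX, sY⟩ := h.contDiffOn L
  refine ⟨⟨(contDiffOn_const.mul sY).congr hφ, (contDiffOn_const.mul sY).congr hθ,
    (sX.div L.smooth_density fun x _ => (L.density_pos x).ne').congr hψ⟩, hflux, fun x hx => ?_⟩
  have hd : deriv (modeFlux pp pm ρ₀ ξ φ θ ψ) x
      = t * X x + g * (r ^ 2 / (4 * om ^ 2 * t⁻¹ + t)) * ρ x * Y x := by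
    refine ((h.hasDerivAt_layerFlux L hx).congr_of_eventuallyEq ?_).deriv
    filter_upwards [Ioo_mem_nhds hx.1 hx.2] with y hy using hflux y hy
  have hρψ : ρ x * ψ x = X x := by
    rw [hψ x hx, layerPsi, mul_div_cancel₀ _ (L.density_pos x).ne']
  rw [hd, hrad x hx, hflux x hx, layerFlux, (hρ x hx).1, hlam]
  -- As the flux is ρY + gρψ, the first two equations reduce to this 2 × 2 system for (φ, θ), with
  -- determinant t² + 4ω²; the given φ and θ are its solution.
  have k1 : t * φ x - 2 * om * θ x = -ξ 0 * Y x := by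
    rw [hφ x hx, hθ x hx]; field_simp; ring
  have k2 : t * θ x + 2 * om * φ x = -ξ 1 * Y x := by
    rw [hφ x hx, hθ x hx]; field_simp; ring
  refine ⟨?_, ?_, ?_⟩
  · linear_combination ρ x * k1 - ξ 0 * g * hρψ
  · linear_combination ρ x * k2 - ξ 1 * g * hρψ
  · linear_combination t * hρψ

theorem EuclideanSpace.sq_add_sq_eq_norm_sq (ξ : EuclideanSpace ℝ (Fin 2)) :
    ξ 0 ^ 2 + ξ 1 ^ 2 = ‖ξ‖ ^ 2 := by
  rw [EuclideanSpace.norm_sq_eq, Fin.sum_univ_two]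
  simp

/-- The equations hold layer by layer; a vanishing flux drop is precisely the remaining jump
condition. -/
theorem IsPairSolution.isNormalMode {g om t l m lam : ℝ} {pp pm ρ₀ ρm Am ρp Ap Xm Ym Xp Yp : ℝ → ℝ}
    {ξ : EuclideanSpace ℝ (Fin 2)}
    (h : IsPairSolution ‖ξ‖ (4 * om ^ 2 * t⁻¹ + t) t l m ρm Am ρp Ap Xm Ym Xp Yp)
    (P : StratifiedPair g l m pp pm ρ₀ ρm Am ρp Ap) (ht : 0 < t) (hlam : lam ^ 2 = t)
    (h0 : fluxDrop g ρm ρp Xm Ym Xp Yp = 0) :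
    IsNormalMode g om l m pp pm ρ₀ ξ lam
      (fun x => -(t * ξ 0 + 2 * om * ξ 1) / (t ^ 2 + 4 * om ^ 2) * glue Ym Yp x)
      (fun x => -(t * ξ 1 - 2 * om * ξ 0) / (t ^ 2 + 4 * om ^ 2) * glue Ym Yp x)
      (glue (layerPsi ρm Xm) (layerPsi ρp Xp)) := by
  obtain ⟨sm, fm, em⟩ := h.lower.normalMode P.lower ht hlam ξ.sq_add_sq_eq_norm_sq P.eq_lower
    (φ := fun x => -(t * ξ 0 + 2 * om * ξ 1) / (t ^ 2 + 4 * om ^ 2) * glue Ym Yp x)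
    (θ := fun x => -(t * ξ 1 - 2 * om * ξ 0) / (t ^ 2 + 4 * om ^ 2) * glue Ym Yp x)
    (ψ := glue (layerPsi ρm Xm) (layerPsi ρp Xp))
    (fun x hx => by rw [glue_of_le hx.2.le]) (fun x hx => by rw [glue_of_le hx.2.le])
    (fun x hx => by rw [glue_of_le hx.2.le])
  obtain ⟨sp, fp, ep⟩ := h.upper.normalMode P.upper ht hlam ξ.sq_add_sq_eq_norm_sq P.eq_upper
    (φ := fun x => -(t * ξ 0 + 2 * om * ξ 1) / (t ^ 2 + 4 * om ^ 2) * glue Ym Yp x)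
    (θ := fun x => -(t * ξ 1 - 2 * om * ξ 0) / (t ^ 2 + 4 * om ^ 2) * glue Ym Yp x)
    (ψ := glue (layerPsi ρm Xm) (layerPsi ρp Xp))
    (fun x hx => by rw [glue_of_gt hx.1]) (fun x hx => by rw [glue_of_gt hx.1])
    (fun x hx => by rw [glue_of_gt hx.1])
  have T := h.isTestPair P
  have hl := P.l_pos
  have hm := P.neg_m_neg
  have hc := (T.isH10.isSobolevPrimitive le_rfl (hm.le.trans hl.le) le_rfl).continuousOn
    (hm.le.trans hl.le)
  have hc0 : ContinuousAt (glue (layerPsi ρm Xm) (layerPsi ρp Xp)) 0 :=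
    hc.continuousAt (Icc_mem_nhds hm hl)
  refine ⟨sm, sp, hc, ?_, ?_, ?_, ⟨_, hc0.mono_left nhdsWithin_le_nhds,
    hc0.mono_left nhdsWithin_le_nhds⟩, ⟨layerFlux g ρp Xp Yp 0, ?_, ?_⟩,
    T.isH10.left (hm.le.trans hl.le), T.isH10.right⟩
  · rintro x (hx | hx)
    exacts [(em x hx).1, (ep x hx).1]
  · rintro x (hx | hx)
    exacts [(em x hx).2.1, (ep x hx).2.1]
  · rintro x (hx | hx)
    exacts [(em x hx).2.2, (ep x hx).2.2]
  · have h1 : Tendsto (layerFlux g ρp Xp Yp) (𝓝[>] 0) (𝓝 (layerFlux g ρp Xp Yp 0)) := by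
      rw [← nhdsWithin_Ioo_eq_nhdsGT hl]
      exact (h.upper.continuousOn_layerFlux P.upper 0 ⟨le_rfl, hl.le⟩).mono Ioo_subset_Icc_self
    refine h1.congr' ?_
    filter_upwards [Ioo_mem_nhdsGT hl] with x hx using (fp x hx).symm
  · have h1 : Tendsto (layerFlux g ρm Xm Ym) (𝓝[<] 0) (𝓝 (layerFlux g ρm Xm Ym 0)) := by
      rw [← nhdsWithin_Ioo_eq_nhdsLT hm]
      exact (h.lower.continuousOn_layerFlux P.lower 0 ⟨hm.le, le_rfl⟩).mono Ioo_subset_Icc_self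
    rw [fluxDrop, sub_eq_zero] at h0
    rw [← h0]
    refine h1.congr' ?_
    filter_upwards [Ioo_mem_nhdsLT hm] with x hx using (fm x hx).symm

theorem Matrix.specialOrthogonalGroup.entries {Q : Matrix (Fin 2) (Fin 2) ℝ}
    (hQ : Q ∈ Matrix.specialOrthogonalGroup (Fin 2) ℝ) :
    Q 1 1 = Q 0 0 ∧ Q 1 0 = -Q 0 1 ∧ Q 0 0 ^ 2 + Q 0 1 ^ 2 = 1 := by
  rw [Matrix.mem_specialOrthogonalGroup_iff, Matrix.mem_orthogonalGroup_iff] at hQ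
  obtain ⟨h1, h2⟩ := hQ
  rw [Matrix.det_fin_two] at h2
  have e00 := congrFun (congrFun h1 0) 0
  have e01 := congrFun (congrFun h1 0) 1
  have e11 := congrFun (congrFun h1 1) 1
  simp [Matrix.mul_apply, Fin.sum_univ_two] at e00 e01 e11
  refine ⟨?_, ?_, by linarith⟩
  · linear_combination Q 0 0 * h2 + Q 0 1 * e01 - Q 1 1 * e00
  · linear_combination -Q 0 1 * h2 + Q 0 0 * e01 - Q 1 0 * e00

theorem rotate_apply (Q : Matrix (Fin 2) (Fin 2) ℝ) (ξ : EuclideanSpace ℝ (Fin 2)) (i : Fin 2) :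
    rotate Q ξ i = Q i 0 * ξ 0 + Q i 1 * ξ 1 := by
  fin_cases i <;> simp [rotate]

theorem norm_rotate {Q : Matrix (Fin 2) (Fin 2) ℝ}
    (hQ : Q ∈ Matrix.specialOrthogonalGroup (Fin 2) ℝ) (ξ : EuclideanSpace ℝ (Fin 2)) :
    ‖rotate Q ξ‖ = ‖ξ‖ := by
  obtain ⟨h1, h2, h3⟩ := Matrix.specialOrthogonalGroup.entries hQ
  rw [← sq_eq_sq₀ (norm_nonneg _) (norm_nonneg _), ← EuclideanSpace.sq_add_sq_eq_norm_sq,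
    ← EuclideanSpace.sq_add_sq_eq_norm_sq, rotate_apply, rotate_apply, h1, h2]
  linear_combination (ξ 0 ^ 2 + ξ 1 ^ 2) * h3

/-! ### Choice of t₀ and conclusion. -/

/-- Admissibility forces the energy infimum below `-C₀ r / 2` for `s = 2 / (C₀ r)`. -/
theorem IsEnergyConstants.muInf_lt {g om l m R₁ C₀ C₁ r : ℝ} {pp pm ρ₀ : ℝ → ℝ}
    (h : IsEnergyConstants g om l m pp pm ρ₀ R₁ C₀ C₁) (hr : constR2 R₁ C₀ C₁ < r) :
    0 < r ∧ muInf g om l m pp pm ρ₀ r (C₀ / 2 * r)⁻¹ < -(C₀ / 2 * r) := by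
  have h0 := h.C₀_pos
  have h1 := h.C₁_pos
  have h2 := h.two_le
  -- With t₀ = C₀r/2, the condition r > R₂ says t₀ > √C₂. The two entries of the maximum C₂ then
  -- give r ≥ R₁ and C₁ < t₀², whence μ ≤ -2t₀ + C₁/t₀ < -t₀.
  have hlt : √(constC2 R₁ C₀ C₁) < C₀ / 2 * r := by
    have : 2 * C₀⁻¹ * √(constC2 R₁ C₀ C₁) < r := hr
    have := mul_lt_mul_of_pos_left this (by positivity : 0 < C₀ / 2)
    rwa [show C₀ / 2 * (2 * C₀⁻¹ * √(constC2 R₁ C₀ C₁)) = √(constC2 R₁ C₀ C₁) by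
      field_simp] at this
  have hR : R₁ ≤ r := by
    have : R₁ * C₀ / 2 ≤ √(constC2 R₁ C₀ C₁) := Real.le_sqrt_of_sq_le (le_max_right _ _)
    refine le_of_mul_le_mul_left ?_ (by positivity : 0 < C₀ / 2)
    linarith
  have hr0 : 0 < r := by linarith
  have ht : 0 < C₀ / 2 * r := by positivity
  refine ⟨hr0, (h.bound r _ hR (inv_pos.2 ht)).trans_lt ?_⟩
  have hsq : C₁ < (C₀ / 2 * r) ^ 2 := by
    have h3 : 4 * C₁ ≤ constC2 R₁ C₀ C₁ := le_max_left _ _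
    have h4 := (Real.sqrt_lt' ht).1 hlt
    linarith
  have : (C₀ / 2 * r)⁻¹ * C₁ < C₀ / 2 * r := by
    rw [inv_mul_lt_iff₀ ht, ← sq]; exact hsq
  linarith

theorem theorem2p2 (g om l m : ℝ) (hg : 0 < g) (hl : 0 < l) (hm : 0 < m)
    (pp pm ρ₀ : ℝ → ℝ) (hpp : IsPressureLaw pp) (hpm : IsPressureLaw pm)
    (hρ : IsSteadyState g l m pp pm ρ₀) :
    (∃ R₁ C₀ C₁ : ℝ, IsEnergyConstants g om l m pp pm ρ₀ R₁ C₀ C₁) ∧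
    ∀ R₁ C₀ C₁ : ℝ, IsEnergyConstants g om l m pp pm ρ₀ R₁ C₀ C₁ →
      ∃ (φ θ ψ : EuclideanSpace ℝ (Fin 2) → ℝ → ℝ) (lam : ℝ → ℝ),
        (∀ ξ : EuclideanSpace ℝ (Fin 2), constR2 R₁ C₀ C₁ < ‖ξ‖ →
          0 < lam ‖ξ‖ ∧
          -(lam ‖ξ‖) ^ 2 = muInf g om l m pp pm ρ₀ ‖ξ‖ ((lam ‖ξ‖) ^ 2)⁻¹ ∧
          IsNormalMode g om l m pp pm ρ₀ ξ (lam ‖ξ‖) (φ ξ) (θ ξ) (ψ ξ) ∧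
          ψ ξ 0 ≠ 0) ∧
        (∀ ξ : EuclideanSpace ℝ (Fin 2), constR2 R₁ C₀ C₁ < ‖ξ‖ →
          ∀ Q ∈ Matrix.specialOrthogonalGroup (Fin 2) ℝ, ∀ x ∈ Icc (-m) l,
            φ (rotate Q ξ) x = Q 0 0 * φ ξ x + Q 0 1 * θ ξ x ∧
            θ (rotate Q ξ) x = Q 1 0 * φ ξ x + Q 1 1 * θ ξ x ∧
            ψ (rotate Q ξ) x = ψ ξ x) ∧
        (∀ ξ : EuclideanSpace ℝ (Fin 2), constR2 R₁ C₀ C₁ < ‖ξ‖ →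
          (C₁ + 1) / C₀ ≤ ‖ξ‖ → C₀ / 2 * ‖ξ‖ - 1 ≤ (lam ‖ξ‖) ^ 2) := by
  obtain ⟨ρm, Am, ρp, Ap, P⟩ := hρ.exists_stratifiedPair hl hm hpp hpm
  refine ⟨P.exists_isEnergyConstants hg om, fun R₁ C₀ C₁ hC => ?_⟩
  have hex : ∀ r : ℝ, constR2 R₁ C₀ C₁ < r → ∃ (t : ℝ) (Xm Ym Xp Yp : ℝ → ℝ),
      0 < r ∧ 0 < t ∧ C₀ / 2 * r ≤ t ∧
      IsPairSolution r (4 * om ^ 2 * t⁻¹ + t) t l m ρm Am ρp Ap Xm Ym Xp Yp ∧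
      fluxDrop g ρm ρp Xm Ym Xp Yp = 0 := fun r hr => by
    obtain ⟨hr0, hmu⟩ := hC.muInf_lt hr
    have ht₀ : 0 < C₀ / 2 * r := mul_pos (half_pos hC.C₀_pos) hr0
    obtain ⟨t, ht, Xm, Ym, Xp, Yp, h, h0⟩ := P.exists_fluxDrop_eq_zero hg.le hr0.le ht₀ hmu
    exact ⟨t, Xm, Ym, Xp, Yp, hr0, ht₀.trans_le ht, ht, h, h0⟩
  -- The choice depends on r = |ξ| only, so ψ and λ are rotation invariant. The direction of ξ
  -- enters through the matrix sending ξ to (φ, θ), which commutes with plane rotations.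
  choose! t Xm Ym Xp Yp hr ht hle hsol hzero using hex
  have hsq : ∀ r : ℝ, constR2 R₁ C₀ C₁ < r → √(t r) ^ 2 = t r := fun r h =>
    Real.sq_sqrt (ht r h).le
  refine ⟨fun ξ x => -(t ‖ξ‖ * ξ 0 + 2 * om * ξ 1) / (t ‖ξ‖ ^ 2 + 4 * om ^ 2) *
      glue (Ym ‖ξ‖) (Yp ‖ξ‖) x,
    fun ξ x => -(t ‖ξ‖ * ξ 1 - 2 * om * ξ 0) / (t ‖ξ‖ ^ 2 + 4 * om ^ 2) *
      glue (Ym ‖ξ‖) (Yp ‖ξ‖) x,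
    fun ξ => glue (layerPsi ρm (Xm ‖ξ‖)) (layerPsi ρp (Xp ‖ξ‖)), fun r => √(t r),
    fun ξ hξ => ⟨Real.sqrt_pos.2 (ht _ hξ), ?_, ?_, ?_⟩, fun ξ hξ Q hQ x hx => ?_,
    fun ξ hξ _ => ?_⟩
  · rw [hsq _ hξ, P.muInf_eq_neg hg.le (hr _ hξ).le (ht _ hξ) (hsol _ hξ) (hzero _ hξ)]
  · exact (hsol _ hξ).isNormalMode P (ht _ hξ) (hsq _ hξ) (hzero _ hξ)
  · exact ((hsol _ hξ).glue_layerPsi_zero P).trans_ne one_ne_zero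
  · obtain ⟨h1, h2, -⟩ := Matrix.specialOrthogonalGroup.entries hQ
    simp only [norm_rotate hQ, rotate_apply, h1, h2, and_true]
    constructor <;> ring
  -- The root lies above t₀, so λ² ≥ C₀|ξ|/2 holds even without the subtracted 1.
  · rw [hsq _ hξ]
    have := hle _ hξ
    linarith
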